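/- Let $\mathbb D$ be the open unit disc, $\partial\mathbb D$ the unit circle, and let $Q$ be the law of a sequence $\alpha=(\alpha_0,\alpha_1,\dots)\in\mathbb D^\infty$ of independent random variables, each with a distribution invariant under all rotations of $\mathbb D$. For $\alpha\in\mathbb D^\infty$ put $\rho_j=\sqrt{1-|\alpha_j|^2}$ and $\Theta_j=\begin{pmatrix}\overline{\alpha_j}&\rho_j\\ \rho_j&-\alpha_j\end{pmatrix}$, let $\mathcal C(\alpha)=\mathrm{diag}(\Theta_0,\Theta_2,\dots)\,\mathrm{diag}(1,\Theta_1,\Theta_3,\dots)$ be the CMV matrix, a unitary operator on $\ell^2(\mathbb N)$, and let $\mu_\alpha$ be the spectral measure of the pair $(\mathcal C(\alpha),\delta_0)$, where $\delta_0=(1,0,0,\dots)$: a probability measure on $\partial\mathbb D$ for which there is an inner-product preserving linear map $V:\ell^2(\mathbb N)\to L^2(\mu_\alpha)$ with $V\delta_0=1$ and $V\mathcal C(\alpha)x=zVx$ for all $x$. Let $\varphi_n=\Phi_n/\|\Phi_n\|_{L^2(\mu_\alpha)}$, where $\Phi_0,\Phi_1,\dots$ are the monic polynomials obtained from $1,z,z^2,\dots$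 by Gram–Schmidt orthogonalization in $L^2(\mu_\alpha)$. Then $\mu_\alpha$ exists for every $\alpha\in\mathbb D^\infty$ and $\alpha\mapsto\mu_\alpha$ is measurable, so that the joint probability measure $d\mathbb P(\alpha,\theta)=dQ(\alpha)\,d\mu_\alpha(\theta)$ on $\mathbb D^\infty\times\partial\mathbb D$ is defined, and the following hold. (i) For each $\theta$ and $n\ge 0$, $|\varphi_n(e^{i\theta})|^{-2}\,dQ(\alpha)$ is a probability measure on $\mathbb D^\infty$, and these measures form a consistent family: for $m\ge n$, the measures with indices $m$ and $n$ agree on $\sigma(\alpha_0,\dots,\alpha_{n-1})$. (ii) There is a Markov kernel $\theta\mapsto Q_\theta$ from $\partial\mathbb D$ to $\mathbb D^\infty$ such that, for every $\theta$, the measure $Q_\theta$ agrees with $|\varphi_n(e^{i\theta})|^{-2}\,dQ$ on $\sigma(\alpha_0,\dots,\alpha_{n-1})$ for each $n\ge0$, and $|\varphi_n(e^{i\theta})|^{-2}\,dQ\to Q_\theta$ weakly on $\mathbb D^\infty$ (with the product topology) as $n\to\infty$. (iii) Under $\mathbb P$ the marginal distribution of $\theta$ is the normalized Lebesgue measure $d\theta/2\pi$,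 and $Q_\theta$ is the regular conditional distribution of $\alpha$ given $\theta$. -/

import Mathlib

open MeasureTheory ProbabilityTheory Filter Topology Complex
open scoped ComplexConjugate ENNReal lp UnitDisc

namespace OPUC

noncomputable section

instance instMeasurableSpaceUnitDisc : MeasurableSpace 𝔻 := borel 𝔻

instance instBorelSpaceUnitDisc : BorelSpace 𝔻 := ⟨rfl⟩

instance instSecondCountableUnitDisc : SecondCountableTopology 𝔻 :=
  UnitDisc.isEmbedding_coe.secondCountableTopology

instance instMeasurableSpaceCircle : MeasurableSpace Circle := borel Circle

instance instBorelSpaceCircle : BorelSpace Circle := ⟨rfl⟩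

/-! ### CMV matrices -/

/-- `ρ = √(1 - |a|²)`. -/
def rho (a : 𝔻) : ℝ := √(1 - ‖(a : ℂ)‖ ^ 2)

/-- The `2 × 2` unitary block `Θ`. -/
def Theta (a : 𝔻) : Matrix (Fin 2) (Fin 2) ℂ :=
  !![conj (a : ℂ), (rho a : ℂ); (rho a : ℂ), -(a : ℂ)]

/-- Action of `diag(Θ₀, Θ₂, Θ₄, …)` on sequences. -/
def actL (α : ℕ → 𝔻) (x : ℕ → ℂ) (i : ℕ) : ℂ :=
  if Even i then Theta (α i) 0 0 * x i + Theta (α i) 0 1 * x (i + 1)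
  else Theta (α (i - 1)) 1 0 * x (i - 1) + Theta (α (i - 1)) 1 1 * x i

/-- Action of `diag(1, Θ₁, Θ₃, …)` on sequences. -/
def actM (α : ℕ → 𝔻) (x : ℕ → ℂ) (i : ℕ) : ℂ :=
  if i = 0 then x 0
  else if Odd i then Theta (α i) 0 0 * x i + Theta (α i) 0 1 * x (i + 1)
  else Theta (α (i - 1)) 1 0 * x (i - 1) + Theta (α (i - 1)) 1 1 * x i

theorem rho_sq (a : 𝔻) : (rho a : ℂ) * (rho a : ℂ) = 1 - (a : ℂ) * conj (a : ℂ) := by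
  have h : (0 : ℝ) ≤ 1 - ‖(a : ℂ)‖ ^ 2 := by
    have := a.sq_norm_lt_one
    linarith
  rw [rho, ← Complex.ofReal_mul, Real.mul_self_sqrt h, Complex.mul_conj, Complex.normSq_eq_norm_sq]
  push_cast
  ring

theorem rho_star (a : 𝔻) : rho (star a) = rho a := by
  simp [rho]

theorem block_norm (a : 𝔻) (u v : ℂ) :
    ‖conj (a : ℂ) * u + rho a * v‖ ^ 2 + ‖rho a * u + -(a : ℂ) * v‖ ^ 2 = ‖u‖ ^ 2 + ‖v‖ ^ 2 := by
  apply Complex.ofReal_injective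
  push_cast
  simp only [← Complex.mul_conj', map_add, map_mul, map_neg, Complex.conj_conj, Complex.conj_ofReal]
  linear_combination (u * conj u + v * conj v) * rho_sq a

theorem hasSum_of_pairs {f g : ℕ → ℝ} {S : ℝ} (hf : ∀ i, 0 ≤ f i)
    (h : ∀ k, f (2 * k) + f (2 * k + 1) = g (2 * k) + g (2 * k + 1)) (hS : HasSum g S) :
    HasSum f S := by
  have he : Summable fun k => g (2 * k) :=
    hS.summable.comp_injective (i := fun k : ℕ => 2 * k) (fun a b hab => by simpa using hab)
  have ho : Summable fun k => g (2 * k + 1) :=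
    hS.summable.comp_injective (i := fun k : ℕ => 2 * k + 1) (fun a b hab => by simpa using hab)
  have hS' : HasSum (fun k => g (2 * k) + g (2 * k + 1)) S := by
    have := he.hasSum.add ho.hasSum
    rwa [(HasSum.even_add_odd he.hasSum ho.hasSum).unique hS] at this
  have fe : Summable fun k => f (2 * k) :=
    Summable.of_nonneg_of_le (fun _ => hf _) (fun k => by linarith [h k, hf (2 * k + 1)]) hS'.summable
  have fo : Summable fun k => f (2 * k + 1) :=
    Summable.of_nonneg_of_le (fun _ => hf _) (fun k => by linarith [h k, hf (2 * k)]) hS'.summable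
  have hadd := fe.hasSum.add fo.hasSum
  simp only [h] at hadd
  have := HasSum.even_add_odd fe.hasSum fo.hasSum
  rwa [hadd.unique hS'] at this

theorem hasSum_of_pairs_shift {f g : ℕ → ℝ} {S : ℝ} (hf : ∀ i, 0 ≤ f i)
    (h0 : f 0 = g 0)
    (h : ∀ k, f (2 * k + 1) + f (2 * k + 2) = g (2 * k + 1) + g (2 * k + 2)) (hS : HasSum g S) :
    HasSum f S := by
  rw [← hasSum_nat_add_iff' 1] at hS ⊢
  simp only [Finset.range_one, Finset.sum_singleton, h0] at hS ⊢
  exact hasSum_of_pairs (fun _ => hf _) (fun k => h k) hS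

theorem hasSum_sq (x : ℓ²(ℕ, ℂ)) : HasSum (fun i => ‖x i‖ ^ 2) (‖x‖ ^ 2) := by
  simpa using lp.hasSum_norm (p := 2) (by simp) x

theorem hasSum_actL (α : ℕ → 𝔻) (x : ℓ²(ℕ, ℂ)) :
    HasSum (fun i => ‖actL α x i‖ ^ 2) (‖x‖ ^ 2) := by
  refine hasSum_of_pairs (fun _ => by positivity) (fun k => ?_)
    (hasSum_sq x)
  simpa [actL, Theta] using block_norm (α (2 * k)) (x (2 * k)) (x (2 * k + 1))

theorem hasSum_actM (α : ℕ → 𝔻) (x : ℓ²(ℕ, ℂ)) :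
    HasSum (fun i => ‖actM α x i‖ ^ 2) (‖x‖ ^ 2) := by
  refine hasSum_of_pairs_shift (fun _ => by positivity) (by simp [actM])
    (fun k => ?_) (hasSum_sq x)
  have h : ¬ Odd (2 * k + 2) := by
    rw [Nat.not_odd_iff_even]
    exact ⟨k + 1, by ring⟩
  simpa [actM, Theta, h] using block_norm (α (2 * k + 1)) (x (2 * k + 1)) (x (2 * k + 2))

theorem actL_star (α : ℕ → 𝔻) (x : ℕ → ℂ) : actL (fun i => star (α i)) (actL α x) = x := by
  funext i
  rcases Nat.even_or_odd' i with ⟨k, rfl | rfl⟩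
  · simp [actL, Theta, rho_star]
    linear_combination x (2 * k) * rho_sq (α (2 * k))
  · simp [actL, Theta, rho_star]
    linear_combination x (2 * k + 1) * rho_sq (α (2 * k))

theorem actM_star (α : ℕ → 𝔻) (x : ℕ → ℂ) : actM (fun i => star (α i)) (actM α x) = x := by
  funext i
  rcases i with _ | i
  · simp [actM]
  rcases Nat.even_or_odd' i with ⟨k, rfl | rfl⟩
  · have h : ¬ Odd (2 * k + 1 + 1) := by
      rw [Nat.not_odd_iff_even]
      exact ⟨k + 1, by ring⟩
    simp [actM, Theta, rho_star, h]
    linear_combination x (2 * k + 1) * rho_sq (α (2 * k + 1))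
  · have h : ¬ Odd (2 * k + 1 + 1) := by
      rw [Nat.not_odd_iff_even]
      exact ⟨k + 1, by ring⟩
    simp [actM, Theta, rho_star, h]
    linear_combination x (2 * k + 1 + 1) * rho_sq (α (2 * k + 1))

theorem norm_eq_of_hasSum {x y : ℓ²(ℕ, ℂ)} (h : HasSum (fun i => ‖y i‖ ^ 2) (‖x‖ ^ 2)) :
    ‖y‖ = ‖x‖ := by
  have := (hasSum_sq y).unique h
  exact (sq_eq_sq₀ (norm_nonneg _) (norm_nonneg _)).1 this

/-- The unitary operator `𝓛 = diag(Θ₀, Θ₂, Θ₄, …)` on `ℓ²(ℕ)`. -/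
def opL (α : ℕ → 𝔻) : ℓ²(ℕ, ℂ) ≃ₗᵢ[ℂ] ℓ²(ℕ, ℂ) where
  toFun x := ⟨actL α x, memℓp_gen (by simpa using (hasSum_actL α x).summable)⟩
  invFun x := ⟨actL (fun i => star (α i)) x,
    memℓp_gen (by simpa using (hasSum_actL (fun i => star (α i)) x).summable)⟩
  map_add' x y := by
    ext i
    simp only [actL, lp.coeFn_add, Pi.add_apply]
    split_ifs <;> ring
  map_smul' c x := by
    ext i
    simp only [actL, lp.coeFn_smul, Pi.smul_apply, RingHom.id_apply, smul_eq_mul]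
    split_ifs <;> ring
  left_inv x := by
    ext i
    exact congrFun (actL_star α x) i
  right_inv x := by
    ext i
    simpa using congrFun (actL_star (fun i => star (α i)) x) i
  norm_map' x := norm_eq_of_hasSum (hasSum_actL α x)

/-- The unitary operator `𝓜 = diag(1, Θ₁, Θ₃, …)` on `ℓ²(ℕ)`. -/
def opM (α : ℕ → 𝔻) : ℓ²(ℕ, ℂ) ≃ₗᵢ[ℂ] ℓ²(ℕ, ℂ) where
  toFun x := ⟨actM α x, memℓp_gen (by simpa using (hasSum_actM α x).summable)⟩
  invFun x := ⟨actM (fun i => star (α i)) x,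
    memℓp_gen (by simpa using (hasSum_actM (fun i => star (α i)) x).summable)⟩
  map_add' x y := by
    ext i
    simp only [actM, lp.coeFn_add, Pi.add_apply]
    split_ifs <;> ring
  map_smul' c x := by
    ext i
    simp only [actM, lp.coeFn_smul, Pi.smul_apply, RingHom.id_apply, smul_eq_mul]
    split_ifs <;> ring
  left_inv x := by
    ext i
    exact congrFun (actM_star α x) i
  right_inv x := by
    ext i
    simpa using congrFun (actM_star (fun i => star (α i)) x) i
  norm_map' x := norm_eq_of_hasSum (hasSum_actM α x)

/-- The CMV matrix `𝓒(α) = 𝓛 𝓜`, as a unitary operator on `ℓ²(ℕ)`. -/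
def cmv (α : ℕ → 𝔻) : ℓ²(ℕ, ℂ) ≃ₗᵢ[ℂ] ℓ²(ℕ, ℂ) := (opM α).trans (opL α)

/-! ### Spectral measures -/

/-- `μ` is a spectral measure of the pair `(U, ζ)`: a probability measure on the circle such that
some inner-product preserving linear `V : H → L²(μ)` maps `ζ` to the constant `1` and turns `U`
into multiplication by `z`. -/
def IsSpectralMeasure {H : Type*} [NormedAddCommGroup H] [InnerProductSpace ℂ H]
    (U : H ≃ₗᵢ[ℂ] H) (ζ : H) (μ : Measure Circle) : Prop :=
  IsProbabilityMeasure μ ∧ ∃ V : H →ₗᵢ[ℂ] Lp ℂ 2 μ,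
    (∀ x, (V (U x) : Circle → ℂ) =ᵐ[μ] fun z => (z : ℂ) * V x z) ∧
    (V ζ : Circle → ℂ) =ᵐ[μ] fun _ => 1

/-- `δ₀ = (1, 0, 0, …)`. -/
def delta0 : ℓ²(ℕ, ℂ) := lp.single 2 0 1

open Classical in
/-- `μ_α`, the spectral measure of the pair `(𝓒(α), δ₀)`. -/
def spectralMeasure (α : ℕ → 𝔻) : Measure Circle :=
  if h : ∃ μ, IsSpectralMeasure (cmv α) delta0 μ then h.choose else 0

/-! ### Orthogonal polynomials on the unit circle -/

/-- The inner product of `L²(μ)`, antilinear in the first factor, on polynomials. -/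
def polyInner (μ : Measure Circle) (p q : Polynomial ℂ) : ℂ :=
  ∫ z : Circle, conj (p.eval (z : ℂ)) * q.eval (z : ℂ) ∂μ

/-- `Φ_n`, the monic orthogonal polynomials of `μ`, from `1, z, z², …` by Gram-Schmidt in
`L²(μ)`. -/
def monicOP (μ : Measure Circle) (n : ℕ) : Polynomial ℂ :=
  Polynomial.X ^ n - ∑ k : Fin n,
    Polynomial.C (polyInner μ (monicOP μ k) (Polynomial.X ^ n) /
      polyInner μ (monicOP μ k) (monicOP μ k)) * monicOP μ k
termination_by n
decreasing_by all_goals exact k.2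

/-- `φ_n = Φ_n / ‖Φ_n‖`, the norm being that of `L²(μ)`. -/
def normalizedOP (μ : Measure Circle) (n : ℕ) : Polynomial ℂ :=
  Polynomial.C (((√(∫ z : Circle, ‖(monicOP μ n).eval (z : ℂ)‖ ^ 2 ∂μ))⁻¹ : ℝ) : ℂ) *
    monicOP μ n

/-! ### Measures -/

/-- Normalized Lebesgue measure `dθ / 2π` on the circle. -/
def lebesgueCircle : Measure Circle :=
  (ENNReal.ofReal (1 / (2 * Real.pi)) • volume.restrict (Set.Ico 0 (2 * Real.pi))).map Circle.exp

/-- The joint measure `dQ(α) dμ_α(θ)`. -/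
def jointMeasure (Q : Measure (ℕ → 𝔻)) : Measure ((ℕ → 𝔻) × Circle) :=
  Q.bind fun α => (spectralMeasure α).map fun z => (α, z)

/-- The measure `|φ_n(z)|⁻² dQ`, where `z = e^{iθ}`. -/
def biased (Q : Measure (ℕ → 𝔻)) (z : Circle) (n : ℕ) : Measure (ℕ → 𝔻) :=
  Q.withDensity fun α =>
    ENNReal.ofReal ((‖(normalizedOP (spectralMeasure α) n).eval (z : ℂ)‖ ^ 2)⁻¹)

/-- The σ-algebra on `𝔻^∞` generated by the first `n` coordinates `α_0, …, α_{n-1}`. -/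
abbrev coordSigma (n : ℕ) : MeasurableSpace (ℕ → 𝔻) :=
  MeasurableSpace.comap (fun α (k : Fin n) => α k) inferInstance

end

end OPUC

/-!
For independent rotation-invariant Verblunsky coefficients, disintegrating the joint law of
`(α, θ)` over `θ` amounts to replacing the law `Q` of `α` by the limit of `|φ_n(e^{iθ})|⁻² dQ`.

**Spectral measures.** The Szegő recursion defines monic polynomials `Φ_n` from `α` without
reference to a measure. On the closed disc `Φ_n^*` has no zeros, so by the mean value property `Φ_n`
is orthogonal to `1, …, z^{n-1}` for the Bernstein–Szegő measure `|φ_n|⁻² dθ/2π`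
(`isOrth_bernsteinSzego`). Orthogonality descends to lower indices by the inverse recursion
(`IsOrth.of_succ`) and determines the first `n` moments (`IsOrth.polyInner_one_eq`), so by
compactness these measures converge weakly (`exists_tendsto_bernsteinSzego`) to a measure for which
every `Φ_n` is orthogonal. In its `L²` space the CMV basis, a rearrangement of the `φ_n` and
`φ_n^*` multiplied by powers of `z⁻¹`, is orthonormal, and the two factors of the CMV matrix express
the recursion: `𝓛` sends the CMV basis to `z` times the alternate basis, and `𝓜` the alternate basis
to the CMV basis. Hence the limit is the spectral measure (`isSpectralMeasure_of_isOrth`), the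
only one since the moments `⟪δ₀, 𝓒ᵏ δ₀⟫` are prescribed. The Gram–Schmidt polynomials of this measure
are the `Φ_n` (`monicOP_eq_szego`), and as a limit of explicit densities it depends measurably on
`α`.

**The conditional law.** With `w_n = Φ_n^* / (z Φ_n)`, a point of the circle depending only on
`α_0, …, α_{n-1}`, one has `|φ_{n+1}|⁻² = |φ_n|⁻² P(w_n⁻¹ α_n)` with the Poisson kernel
`P(x) = (1 - |x|²) / |1 - x|²` (`bsDensity_succ`). In the coefficients `β_n = w_n⁻¹ α_n` the density
is a product, and `w_n` is the explicit product `z^{-(n+1)} ∏_{k<n} (1 - β_k) / (1 - conj β_k)`. So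
`Q_θ` is the law of `α_n = w_n β_n` for independent `β_n` whose laws are those of the `α_n` under `Q`
weighted by `P`; these weighted laws are probability measures because the circle mean of `P` is `1`.
Rotation invariance and induction on `n` identify `Q_θ` with `|φ_n|⁻² dQ` on functions of `n`
coefficients (`lintegral_tiltedLaw`). This gives consistency and, cylinder sets forming a π-system
that contains a neighbourhood basis, weak convergence.

**The joint law.** For a cylinder set `A`, the measures `∫_A |φ_N|⁻² dQ dθ/2π` have density
`Q_θ(A)` once `N` is large, while they converge weakly to `∫_A μ_α dQ(α)`. So
`∫_A μ_α dQ(α) = Q_θ(A) dθ/2π` (`bind_spectralKernel_restrict`), which gives both the uniform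
marginal and the conditional law.
-/

namespace OPUC

open Polynomial
open scoped BoundedContinuousFunction NNReal

/-! ### The Szegő recursion -/

/-- The pairs `(Φ_n, Φ_n^*)` generated from the coefficients `α` by the Szegő recursion
`Φ_{n+1} = z Φ_n - conj α_n Φ_n^*`, `Φ_{n+1}^* = Φ_n^* - α_n z Φ_n`. -/
noncomputable def szegoPair (α : ℕ → 𝔻) : ℕ → ℂ[X] × ℂ[X]
  | 0 => (1, 1)
  | n + 1 => (X * (szegoPair α n).1 - C (conj (α n : ℂ)) * (szegoPair α n).2,
      (szegoPair α n).2 - C (α n : ℂ) * (X * (szegoPair α n).1))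

/-- The monic polynomial `Φ_n` of the Szegő recursion. -/
noncomputable def szego (α : ℕ → 𝔻) (n : ℕ) : ℂ[X] := (szegoPair α n).1

/-- The reversed polynomial `Φ_n^*` of the Szegő recursion. -/
noncomputable def szegoStar (α : ℕ → 𝔻) (n : ℕ) : ℂ[X] := (szegoPair α n).2

/-- `∏_{k<n} ρ_k²`, which is the squared norm of `Φ_n`. -/
noncomputable def normProd (α : ℕ → 𝔻) (n : ℕ) : ℝ := ∏ k ∈ Finset.range n, (1 - ‖(α k : ℂ)‖ ^ 2)

section Szego

variable (α : ℕ → 𝔻)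

@[simp] theorem szego_zero : szego α 0 = 1 := rfl

@[simp] theorem szegoStar_zero : szegoStar α 0 = 1 := rfl

theorem szego_succ (n : ℕ) :
    szego α (n + 1) = X * szego α n - C (conj (α n : ℂ)) * szegoStar α n := rfl

theorem szegoStar_succ (n : ℕ) :
    szegoStar α (n + 1) = szegoStar α n - C (α n : ℂ) * (X * szego α n) := rfl

theorem one_sub_sq_pos (a : 𝔻) : 0 < 1 - ‖(a : ℂ)‖ ^ 2 := by
  linarith [a.sq_norm_lt_one]

theorem normProd_pos (n : ℕ) : 0 < normProd α n :=
  Finset.prod_pos fun k _ => one_sub_sq_pos (α k)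

theorem normProd_succ (n : ℕ) :
    normProd α (n + 1) = normProd α n * (1 - ‖(α n : ℂ)‖ ^ 2) :=
  Finset.prod_range_succ _ _

theorem one_sub_mul_conj (a : 𝔻) :
    ((1 - ‖(a : ℂ)‖ ^ 2 : ℝ) : ℂ) = 1 - (a : ℂ) * conj (a : ℂ) := by
  rw [Complex.mul_conj']; push_cast; ring

theorem natDegree_szego_aux (n : ℕ) :
    (szego α n).Monic ∧ (szego α n).natDegree = n ∧ (szegoStar α n).natDegree ≤ n := by
  induction n with
  | zero => simp
  | succ n ih =>
    obtain ⟨h1, h2, h3⟩ := ih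
    have hm : (X * szego α n).Monic := monic_X.mul h1
    have hd : (X * szego α n).natDegree = n + 1 := by
      rw [monic_X.natDegree_mul h1, h2, natDegree_X, add_comm]
    have hlt : (C (conj (α n : ℂ)) * szegoStar α n).natDegree < (X * szego α n).natDegree := by
      rw [hd]; exact Nat.lt_succ_of_le ((natDegree_C_mul_le _ _).trans h3)
    refine ⟨?_, ?_, ?_⟩
    · rw [szego_succ]
      exact hm.sub_of_left (degree_lt_degree hlt)
    · rw [szego_succ, natDegree_sub_eq_left_of_natDegree_lt hlt, hd]
    · rw [szegoStar_succ]
      refine (natDegree_sub_le _ _).trans (max_le (h3.trans n.le_succ) ?_)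
      exact (natDegree_C_mul_le _ _).trans hd.le

theorem szego_monic (n : ℕ) : (szego α n).Monic := (natDegree_szego_aux α n).1

theorem natDegree_szego (n : ℕ) : (szego α n).natDegree = n := (natDegree_szego_aux α n).2.1

theorem natDegree_szegoStar_le (n : ℕ) : (szegoStar α n).natDegree ≤ n :=
  (natDegree_szego_aux α n).2.2

/-- On the unit circle `Φ_n^*(z) = zⁿ conj (Φ_n(z))`. -/
theorem eval_szegoStar (n : ℕ) (z : Circle) :
    (szegoStar α n).eval (z : ℂ) = (z : ℂ) ^ n * conj ((szego α n).eval (z : ℂ)) := by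
  have hz : (z : ℂ) * conj (z : ℂ) = 1 := by rw [Complex.mul_conj]; simp
  induction n with
  | zero => simp
  | succ n ih =>
    have hzn : (z : ℂ) ^ n * conj (z : ℂ) ^ n = 1 := by rw [← mul_pow, hz, one_pow]
    rw [szego_succ, szegoStar_succ]
    simp only [eval_sub, eval_mul, eval_X, eval_C, map_sub, map_mul, map_pow, Complex.conj_conj, ih]
    linear_combination -(z : ℂ) ^ n * conj ((szego α n).eval (z : ℂ)) * hz +
      (z : ℂ) * (α n : ℂ) * (szego α n).eval (z : ℂ) * hzn

/-- In the closed disc `|Φ_n| ≤ |Φ_n^*|`, and `Φ_n^*` has no zero there: by the recursion,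
`|Φ_{n+1}^*|² - |Φ_{n+1}|² = ρ_n² (|Φ_n^*|² - |z Φ_n|²)`. -/
theorem norm_szego_le_aux (n : ℕ) {w : ℂ} (hw : ‖w‖ ≤ 1) :
    ‖(szego α n).eval w‖ ≤ ‖(szegoStar α n).eval w‖ ∧ (szegoStar α n).eval w ≠ 0 := by
  induction n with
  | zero => simp
  | succ n ih =>
    obtain ⟨h1, h2⟩ := ih
    have hs : 0 < ‖(szegoStar α n).eval w‖ := norm_pos_iff.2 h2
    have h3 : ‖w * (szego α n).eval w‖ ≤ ‖(szegoStar α n).eval w‖ := by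
      rw [norm_mul]; nlinarith [norm_nonneg w, norm_nonneg ((szego α n).eval w)]
    constructor
    · refine le_of_sq_le_sq ?_ (norm_nonneg _)
      have key : ‖(szegoStar α (n + 1)).eval w‖ ^ 2 - ‖(szego α (n + 1)).eval w‖ ^ 2 =
          (1 - ‖(α n : ℂ)‖ ^ 2) *
            (‖(szegoStar α n).eval w‖ ^ 2 - ‖w * (szego α n).eval w‖ ^ 2) := by
        apply Complex.ofReal_injective
        push_cast
        simp only [← Complex.mul_conj', szego_succ, szegoStar_succ, eval_sub, eval_mul, eval_X,
          eval_C, map_sub, map_mul, Complex.conj_conj]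
        ring
      have : 0 ≤ ‖(szegoStar α n).eval w‖ ^ 2 - ‖w * (szego α n).eval w‖ ^ 2 := by
        have := pow_le_pow_left₀ (norm_nonneg _) h3 2
        linarith
      have := mul_nonneg (one_sub_sq_pos (α n)).le this
      linarith
    · intro h
      simp only [szegoStar_succ, eval_sub, eval_mul, eval_X, eval_C, sub_eq_zero] at h
      have h4 := congrArg norm h
      rw [norm_mul] at h4
      have := (α n).norm_lt_one
      nlinarith [norm_nonneg (α n : ℂ)]

theorem szegoStar_ne_zero (n : ℕ) {w : ℂ} (hw : ‖w‖ ≤ 1) : (szegoStar α n).eval w ≠ 0 :=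
  (norm_szego_le_aux α n hw).2

theorem eval_szego_ne_zero (n : ℕ) (z : Circle) : (szego α n).eval (z : ℂ) ≠ 0 := by
  intro h
  refine szegoStar_ne_zero α n (w := z) z.norm_coe.le ?_
  rw [eval_szegoStar, h]; simp

end Szego

/-! ### Orthogonality -/

section Orthogonality

variable {α : ℕ → 𝔻} {μ : Measure Circle}

theorem integrable_of_continuous [IsFiniteMeasure μ] {E : Type*} [NormedAddCommGroup E]
    {f : Circle → E}
    [SecondCountableTopologyEither Circle E] (hf : Continuous f) : Integrable f μ :=
  hf.integrable_of_hasCompactSupport (HasCompactSupport.of_compactSpace f)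

theorem continuous_eval (p : ℂ[X]) : Continuous fun z : Circle => p.eval (z : ℂ) :=
  p.continuous.comp continuous_induced_dom

theorem integrable_polyInner [IsFiniteMeasure μ] (p q : ℂ[X]) :
    Integrable (fun z : Circle => conj (p.eval (z : ℂ)) * q.eval (z : ℂ)) μ :=
  integrable_of_continuous (((Complex.continuous_conj.comp (continuous_eval p))).mul
    (continuous_eval q))

theorem polyInner_sub_right [IsFiniteMeasure μ] (p q r : ℂ[X]) :
    polyInner μ p (q - r) = polyInner μ p q - polyInner μ p r := by
  simp only [polyInner, eval_sub, mul_sub]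
  exact integral_sub (integrable_polyInner p q) (integrable_polyInner p r)

theorem polyInner_add_right [IsFiniteMeasure μ] (p q r : ℂ[X]) :
    polyInner μ p (q + r) = polyInner μ p q + polyInner μ p r := by
  simp only [polyInner, eval_add, mul_add]
  exact integral_add (integrable_polyInner p q) (integrable_polyInner p r)

theorem polyInner_C_mul_right (c : ℂ) (p q : ℂ[X]) :
    polyInner μ p (C c * q) = c * polyInner μ p q := by
  simp only [polyInner, eval_mul, eval_C, ← integral_const_mul]
  congr 1; ext z; ring

theorem polyInner_sum_right [IsFiniteMeasure μ] {ι : Type*} (s : Finset ι) (p : ℂ[X])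
    (q : ι → ℂ[X]) :
    polyInner μ p (∑ i ∈ s, q i) = ∑ i ∈ s, polyInner μ p (q i) := by
  simp only [polyInner, eval_finsetSum, Finset.mul_sum]
  exact integral_finsetSum _ fun i _ => integrable_polyInner p (q i)

theorem conj_polyInner (p q : ℂ[X]) : conj (polyInner μ p q) = polyInner μ q p := by
  rw [polyInner, polyInner, ← integral_conj]
  congr 1; ext z; simp [mul_comm]

theorem conj_mul_self (z : Circle) : conj (z : ℂ) * (z : ℂ) = 1 := by
  rw [mul_comm, Complex.mul_conj]; simp

theorem polyInner_X_mul (p q : ℂ[X]) : polyInner μ (X * p) (X * q) = polyInner μ p q := by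
  rw [polyInner, polyInner]
  congr 1; ext z
  simp only [eval_mul, eval_X, map_mul]
  linear_combination conj (p.eval (z : ℂ)) * q.eval (z : ℂ) * conj_mul_self z

/-- `Φ_k` is orthogonal to `1, z, …, z^{k-1}` in `L²(μ)`. -/
def IsOrth (μ : Measure Circle) (α : ℕ → 𝔻) (k : ℕ) : Prop :=
  ∀ j < k, polyInner μ (X ^ j) (szego α k) = 0

theorem polyInner_szegoStar {j k : ℕ} (hjk : j ≤ k) :
    polyInner μ (X ^ j) (szegoStar α k) = conj (polyInner μ (X ^ (k - j)) (szego α k)) := by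
  rw [conj_polyInner, polyInner, polyInner]
  congr 1; ext z
  have hzj : conj (z : ℂ) ^ j * (z : ℂ) ^ j = 1 := by rw [← mul_pow, conj_mul_self, one_pow]
  have hk : (z : ℂ) ^ k = (z : ℂ) ^ j * (z : ℂ) ^ (k - j) := by rw [← pow_add]; congr 1; omega
  rw [eval_szegoStar, hk]
  simp only [eval_pow, eval_X, map_pow]
  linear_combination (z : ℂ) ^ (k - j) * conj ((szego α k).eval (z : ℂ)) * hzj

theorem polyInner_szegoStar_self (k : ℕ) :
    polyInner μ (szegoStar α k) (szegoStar α k) = polyInner μ (szego α k) (szego α k) := by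
  rw [polyInner, polyInner]
  congr 1; ext z
  have hzk : conj (z : ℂ) ^ k * (z : ℂ) ^ k = 1 := by rw [← mul_pow, conj_mul_self, one_pow]
  rw [eval_szegoStar]
  simp only [map_pow, map_mul, Complex.conj_conj]
  linear_combination
    (szego α k).eval (z : ℂ) * conj ((szego α k).eval (z : ℂ)) * hzk

theorem IsOrth.polyInner_szegoStar_eq_zero {k : ℕ} (h : IsOrth μ α k) {j : ℕ} (hj : 1 ≤ j)
    (hjk : j ≤ k) :
    polyInner μ (X ^ j) (szegoStar α k) = 0 := by
  rw [polyInner_szegoStar hjk, h _ (by omega), map_zero]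

theorem IsOrth.szego_left [IsFiniteMeasure μ] {k : ℕ} (h : IsOrth μ α k) {p : ℂ[X]}
    (hp : p.degree < k) : polyInner μ (szego α k) p = 0 := by
  rcases eq_or_ne p 0 with rfl | h0
  · simp [polyInner]
  rw [p.as_sum_range_C_mul_X_pow' ((natDegree_lt_iff_degree_lt h0).2 hp), polyInner_sum_right]
  refine Finset.sum_eq_zero fun j hj => ?_
  rw [polyInner_C_mul_right, ← conj_polyInner, h j (Finset.mem_range.1 hj), map_zero, mul_zero]

theorem IsOrth.szego_right [IsFiniteMeasure μ] {k : ℕ} (h : IsOrth μ α k) {p : ℂ[X]}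
    (hp : p.degree < k) : polyInner μ p (szego α k) = 0 := by
  rw [← conj_polyInner, h.szego_left hp, map_zero]

/-- The inverse Szegő recursion. -/
theorem X_mul_szego (α : ℕ → 𝔻) (k : ℕ) :
    C ((1 - ‖(α k : ℂ)‖ ^ 2 : ℝ) : ℂ) * (X * szego α k) =
      szego α (k + 1) + C (conj (α k : ℂ)) * szegoStar α (k + 1) := by
  rw [one_sub_mul_conj, szego_succ, szegoStar_succ]
  simp only [map_sub, map_mul, map_one]
  ring

/-- Orthogonality propagates downwards, by the inverse recursion. -/
theorem IsOrth.of_succ [IsFiniteMeasure μ] {k : ℕ} (h : IsOrth μ α (k + 1)) : IsOrth μ α k := by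
  intro j hj
  have h0 : ((1 - ‖(α k : ℂ)‖ ^ 2 : ℝ) : ℂ) ≠ 0 :=
    Complex.ofReal_ne_zero.2 (one_sub_sq_pos (α k)).ne'
  have h1 : polyInner μ (X ^ (j + 1)) (C ((1 - ‖(α k : ℂ)‖ ^ 2 : ℝ) : ℂ) * (X * szego α k)) = 0 := by
    rw [X_mul_szego, polyInner_add_right, polyInner_C_mul_right, h _ (by omega),
      h.polyInner_szegoStar_eq_zero (by omega) (by omega)]
    simp
  rw [polyInner_C_mul_right, pow_succ' X j, polyInner_X_mul] at h1
  exact (mul_eq_zero.1 h1).resolve_left h0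

theorem IsOrth.mono [IsFiniteMeasure μ] {k n : ℕ} (h : IsOrth μ α n) (hk : k ≤ n) :
    IsOrth μ α k := by
  induction n, hk using Nat.le_induction with
  | base => exact h
  | succ n _ ih => exact ih h.of_succ

/-- `‖Φ_{k+1}‖² = ρ_k² ‖Φ_k‖²`: Pythagoras for `z Φ_k = Φ_{k+1} + conj α_k Φ_k^*`. -/
theorem IsOrth.polyInner_self_succ [IsFiniteMeasure μ] {k : ℕ} (h : IsOrth μ α (k + 1)) :
    polyInner μ (szego α (k + 1)) (szego α (k + 1)) =
      ((1 - ‖(α k : ℂ)‖ ^ 2 : ℝ) : ℂ) * polyInner μ (szego α k) (szego α k) := by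
  have hX : X * szego α k = szego α (k + 1) + C (conj (α k : ℂ)) * szegoStar α k := by
    rw [szego_succ]; ring
  have hdeg : (szegoStar α k).degree < ((k + 1 : ℕ) : WithBot ℕ) :=
    lt_of_le_of_lt degree_le_natDegree
      (by exact_mod_cast Nat.lt_succ_of_le (natDegree_szegoStar_le α k))
  have h1 : polyInner μ (szego α (k + 1)) (X * szego α k) =
      polyInner μ (szego α (k + 1)) (szego α (k + 1)) := by
    rw [hX, polyInner_add_right, polyInner_C_mul_right, h.szego_left hdeg]; simp
  have h2 : polyInner μ (szegoStar α k) (X * szego α k) =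
      conj (α k : ℂ) * polyInner μ (szego α k) (szego α k) := by
    rw [hX, polyInner_add_right, polyInner_C_mul_right, h.szego_right hdeg,
      polyInner_szegoStar_self, zero_add]
  have h3 : polyInner μ (X * szego α k) (X * szego α k) =
      polyInner μ (X * szego α k) (szego α (k + 1)) +
        conj (α k : ℂ) * polyInner μ (X * szego α k) (szegoStar α k) := by
    rw [← polyInner_C_mul_right, ← polyInner_add_right, ← hX]
  have hself : conj (polyInner μ (szego α k) (szego α k)) =
    polyInner μ (szego α k) (szego α k) := conj_polyInner _ _
  rw [← conj_polyInner (szego α (k + 1)) (X * szego α k), h1, conj_polyInner,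
    ← conj_polyInner (szegoStar α k) (X * szego α k), h2, polyInner_X_mul, map_mul,
    Complex.conj_conj, hself] at h3
  rw [one_sub_mul_conj]
  linear_combination -h3

theorem IsOrth.polyInner_self [IsFiniteMeasure μ] {n : ℕ} (h : IsOrth μ α n) :
    polyInner μ (szego α n) (szego α n) = normProd α n * polyInner μ 1 1 := by
  induction n with
  | zero => simp [normProd]
  | succ n ih =>
    rw [h.polyInner_self_succ, ih h.of_succ, normProd_succ]
    push_cast
    ring

theorem polyInner_one_one [IsProbabilityMeasure μ] : polyInner μ 1 1 = 1 := by
  simp [polyInner]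

/-- Orthogonality of `Φ_n` determines the integrals of the polynomials of degree at most `n`. -/
theorem IsOrth.polyInner_one_eq {μ' : Measure Circle} [IsProbabilityMeasure μ]
    [IsProbabilityMeasure μ'] {n : ℕ} (h : IsOrth μ α n) (h' : IsOrth μ' α n) (p : ℂ[X])
    (hp : p.natDegree ≤ n) : polyInner μ 1 p = polyInner μ' 1 p := by
  induction n generalizing p with
  | zero =>
    rw [eq_C_of_natDegree_le_zero hp, ← mul_one (C _), polyInner_C_mul_right,
      polyInner_C_mul_right, polyInner_one_one, polyInner_one_one]
  | succ n ih =>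
    set c := p.coeff (n + 1) with hc
    have hr : (p - C c * szego α (n + 1)).natDegree ≤ n := by
      rw [natDegree_le_iff_coeff_eq_zero]
      intro N hN
      rw [coeff_sub, coeff_C_mul]
      rcases (Nat.succ_le_of_lt hN).eq_or_lt with rfl | hN'
      · have := (szego_monic α (n + 1)).coeff_natDegree
        rw [natDegree_szego] at this
        simp [this, hc]
      · rw [coeff_eq_zero_of_natDegree_lt (lt_of_le_of_lt hp hN'),
          coeff_eq_zero_of_natDegree_lt (by rwa [natDegree_szego]), mul_zero, sub_zero]
    have h1 := ih h.of_succ h'.of_succ _ hr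
    have e1 := h 0 (Nat.succ_pos n)
    have e2 := h' 0 (Nat.succ_pos n)
    rw [pow_zero] at e1 e2
    rwa [polyInner_sub_right, polyInner_sub_right, polyInner_C_mul_right, polyInner_C_mul_right,
      e1, e2, mul_zero, sub_zero, sub_zero] at h1

end Orthogonality

/-! ### Bernstein–Szegő measures -/

theorem measurable_circleExp : Measurable Circle.exp := Circle.exp.continuous.measurable

instance : IsProbabilityMeasure lebesgueCircle := by
  constructor
  rw [lebesgueCircle, Measure.map_apply measurable_circleExp MeasurableSet.univ]
  simp only [Set.preimage_univ, Measure.smul_apply, Measure.restrict_apply MeasurableSet.univ,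
    Set.univ_inter, Real.volume_Ico, sub_zero, smul_eq_mul]
  rw [← ENNReal.ofReal_mul (by positivity), one_div, inv_mul_cancel₀ (by positivity),
    ENNReal.ofReal_one]

theorem integral_lebesgueCircle (f : ℂ → ℂ) (hf : Continuous fun z : Circle => f z) :
    ∫ z : Circle, f z ∂lebesgueCircle = Real.circleAverage f 0 1 := by
  rw [lebesgueCircle, integral_map measurable_circleExp.aemeasurable
    hf.measurable.aestronglyMeasurable, integral_smul_measure, Real.circleAverage,
    intervalIntegral.integral_of_le (by positivity), integral_Ico_eq_integral_Ioc,
    ENNReal.toReal_ofReal (by positivity), one_div]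
  simp [circleMap]

section BernsteinSzego

variable (α : ℕ → 𝔻)

/-- The density `|φ_n|^{-2} = ∏_{k<n} ρ_k² / |Φ_n|²`. -/
noncomputable def bsDensity (n : ℕ) (z : Circle) : ℝ :=
  normProd α n / ‖(szego α n).eval (z : ℂ)‖ ^ 2

/-- The Bernstein–Szegő measure `|φ_n|^{-2} dθ/2π`. -/
noncomputable def bernsteinSzego (n : ℕ) : Measure Circle :=
  lebesgueCircle.withDensity fun z => ENNReal.ofReal (bsDensity α n z)

theorem continuous_bsDensity (n : ℕ) : Continuous (bsDensity α n) :=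
  continuous_const.div ((continuous_eval _).norm.pow 2) fun z => by
    have := eval_szego_ne_zero α n z
    positivity

theorem bsDensity_nonneg (n : ℕ) (z : Circle) : 0 ≤ bsDensity α n z :=
  div_nonneg (normProd_pos α n).le (by positivity)

theorem integral_bernsteinSzego (n : ℕ) (f : Circle → ℂ) :
    ∫ z, f z ∂(bernsteinSzego α n) = ∫ z, (bsDensity α n z : ℂ) * f z ∂lebesgueCircle := by
  rw [bernsteinSzego, integral_withDensity_eq_integral_toReal_smul
    (continuous_bsDensity α n).measurable.ennreal_ofReal (by simp)]
  congr 1; ext z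
  rw [ENNReal.toReal_ofReal (bsDensity_nonneg α n z), Complex.real_smul]

instance isFiniteMeasure_bernsteinSzego (n : ℕ) : IsFiniteMeasure (bernsteinSzego α n) :=
  isFiniteMeasure_withDensity_ofReal
    (integrable_of_continuous (continuous_bsDensity α n)).hasFiniteIntegral

/-- On the circle `conj (z^j) Φ_n / |Φ_n|² = z^{n-j} / Φ_n^*`, which is analytic in the closed disc
and vanishes at the origin. -/
theorem isOrth_bernsteinSzego (n : ℕ) : IsOrth (bernsteinSzego α n) α n := by
  intro j hj
  rw [polyInner, integral_bernsteinSzego]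
  let F : ℂ → ℂ := fun w => normProd α n * (w ^ (n - j) / (szegoStar α n).eval w)
  have key : ∀ z : Circle, (bsDensity α n z : ℂ) *
      (conj ((X ^ j : ℂ[X]).eval (z : ℂ)) * (szego α n).eval (z : ℂ)) = F z := by
    intro z
    have h0 := eval_szego_ne_zero α n z
    have h1 : conj ((szego α n).eval (z : ℂ)) ≠ 0 := by simpa using h0
    have hz := z.coe_ne_zero
    have hzj : conj (z : ℂ) ^ j * (z : ℂ) ^ j = 1 := by rw [← mul_pow, conj_mul_self, one_pow]
    have hk : (z : ℂ) ^ n = (z : ℂ) ^ j * (z : ℂ) ^ (n - j) := by rw [← pow_add]; congr 1; omega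
    simp only [F, bsDensity, eval_pow, eval_X, map_pow, eval_szegoStar]
    push_cast
    rw [← Complex.mul_conj', hk]
    field_simp
    linear_combination (normProd α n : ℂ) * hzj
  have hc : Continuous fun z : Circle => F z :=
    continuous_const.mul ((continuous_induced_dom.pow _).div (continuous_eval _)
      fun z => szegoStar_ne_zero α n z.norm_coe.le)
  have hd : DifferentiableOn ℂ F (Metric.closedBall 0 1) := by
    intro w hw
    have := szegoStar_ne_zero α n (mem_closedBall_zero_iff.1 hw)
    exact ((differentiableAt_const _).mul ((differentiableAt_pow _).fun_div
      (szegoStar α n).differentiable.differentiableAt this)).differentiableWithinAt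
  rw [integral_congr_ae (Eventually.of_forall key), integral_lebesgueCircle F hc,
    DiffContOnCl.circleAverage]
  · simp [F, show n - j ≠ 0 by omega]
  · rw [abs_one]
    exact DifferentiableOn.diffContOnCl (by rwa [closure_ball _ one_ne_zero])

instance isProbabilityMeasure_bernsteinSzego (n : ℕ) :
    IsProbabilityMeasure (bernsteinSzego α n) := by
  have h := (isOrth_bernsteinSzego α n).polyInner_self
  have h1 : polyInner (bernsteinSzego α n) (szego α n) (szego α n) = normProd α n := by
    rw [polyInner, integral_bernsteinSzego]
    have : ∀ z : Circle, (bsDensity α n z : ℂ) * (conj ((szego α n).eval (z : ℂ)) *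
        (szego α n).eval (z : ℂ)) = normProd α n := by
      intro z
      have h0 := eval_szego_ne_zero α n z
      have h1 : conj ((szego α n).eval (z : ℂ)) ≠ 0 := by simpa using h0
      rw [bsDensity]
      push_cast
      rw [← Complex.mul_conj']
      field_simp
    simp [this]
  rw [h1] at h
  have h2 : polyInner (bernsteinSzego α n) 1 1 = 1 := by
    have h0 : (normProd α n : ℂ) ≠ 0 := Complex.ofReal_ne_zero.2 (normProd_pos α n).ne'
    exact mul_left_cancel₀ h0 (by rw [← h, mul_one])
  have h3 : (bernsteinSzego α n).real Set.univ = 1 := by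
    simpa [polyInner] using h2
  exact (isProbabilityMeasure_iff_real).2 h3

end BernsteinSzego

/-! ### Measures on the circle and their moments -/

theorem exists_conj_eval_eq (p : ℂ[X]) :
    ∃ (d : ℕ) (r : ℂ[X]), ∀ z : Circle,
      conj (p.eval (z : ℂ)) = conj (z : ℂ) ^ d * r.eval (z : ℂ) := by
  induction p using Polynomial.induction_on' with
  | add p q hp hq =>
    obtain ⟨d, r, h⟩ := hp
    obtain ⟨e, s, h'⟩ := hq
    refine ⟨d + e, X ^ e * r + X ^ d * s, fun z => ?_⟩
    have hd : conj (z : ℂ) ^ d * (z : ℂ) ^ d = 1 := by rw [← mul_pow, conj_mul_self, one_pow]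
    have he : conj (z : ℂ) ^ e * (z : ℂ) ^ e = 1 := by rw [← mul_pow, conj_mul_self, one_pow]
    simp only [eval_add, map_add, h, h', eval_mul, eval_pow, eval_X, pow_add]
    linear_combination -conj (z : ℂ) ^ d * r.eval (z : ℂ) * he -
      conj (z : ℂ) ^ e * s.eval (z : ℂ) * hd
  | monomial n a =>
    exact ⟨n, C (conj a), fun z => by simp [mul_comm]⟩

/-- The star algebra of Laurent polynomials, as functions on the circle. -/
def laurentAlgebra : StarSubalgebra ℂ (Circle →ᵇ ℂ) where
  carrier := {g | ∃ (d : ℕ) (r : ℂ[X]), ∀ z : Circle, g z = conj (z : ℂ) ^ d * r.eval (z : ℂ)}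
  mul_mem' := by
    rintro f g ⟨d, r, h⟩ ⟨e, s, h'⟩
    refine ⟨d + e, r * s, fun z => ?_⟩
    rw [BoundedContinuousFunction.mul_apply, h, h', eval_mul, pow_add]
    ring
  add_mem' := by
    rintro f g ⟨d, r, h⟩ ⟨e, s, h'⟩
    refine ⟨d + e, X ^ e * r + X ^ d * s, fun z => ?_⟩
    have hd : conj (z : ℂ) ^ d * (z : ℂ) ^ d = 1 := by rw [← mul_pow, conj_mul_self, one_pow]
    have he : conj (z : ℂ) ^ e * (z : ℂ) ^ e = 1 := by rw [← mul_pow, conj_mul_self, one_pow]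
    simp only [BoundedContinuousFunction.add_apply, eval_add, h, h', eval_mul, eval_pow, eval_X,
      pow_add]
    linear_combination -conj (z : ℂ) ^ d * r.eval (z : ℂ) * he -
      conj (z : ℂ) ^ e * s.eval (z : ℂ) * hd
  algebraMap_mem' c := ⟨0, C c, fun z => by simp⟩
  star_mem' := by
    rintro f ⟨d, r, h⟩
    obtain ⟨e, s, h'⟩ := exists_conj_eval_eq r
    refine ⟨e, X ^ d * s, fun z => ?_⟩
    simp only [BoundedContinuousFunction.star_apply, h, RCLike.star_def, map_mul, map_pow,
      Complex.conj_conj, h', eval_mul, eval_pow, eval_X]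
    ring

theorem laurentAlgebra_separatesPoints :
    (laurentAlgebra.map
      (BoundedContinuousFunction.toContinuousMapStarₐ ℂ)).SeparatesPoints := by
  intro z w hzw
  let f : C(Circle, ℂ) := ⟨fun z => (z : ℂ), continuous_induced_dom⟩
  refine ⟨f, ⟨f, ⟨BoundedContinuousFunction.mkOfCompact f, ⟨0, X, fun z => by simp; rfl⟩, ?_⟩, rfl⟩,
    fun h => hzw (Circle.coe_injective h)⟩
  ext x; rfl

/-- A probability measure on the circle is determined by its moments of nonnegative order. -/
theorem measure_ext_of_polyInner_one {μ ν : Measure Circle} [IsProbabilityMeasure μ]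
    [IsProbabilityMeasure ν] (h : ∀ k : ℕ, polyInner μ 1 (X ^ k) = polyInner ν 1 (X ^ k)) :
    μ = ν := by
  have hX : ∀ d k : ℕ, polyInner μ (X ^ d) (X ^ k) = polyInner ν (X ^ d) (X ^ k) := by
    intro d
    induction d with
    | zero => simpa using h
    | succ d ih =>
      rintro (_ | k)
      · rw [← conj_polyInner, ← conj_polyInner (μ := ν), pow_zero, h]
      · rw [pow_succ' X d, pow_succ' X k, polyInner_X_mul, polyInner_X_mul, ih]
  have hp : ∀ (d : ℕ) (p : ℂ[X]), polyInner μ (X ^ d) p = polyInner ν (X ^ d) p := by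
    intro d p
    rw [p.as_sum_range_C_mul_X_pow, polyInner_sum_right, polyInner_sum_right]
    simp only [polyInner_C_mul_right, hX]
  refine ext_of_forall_mem_subalgebra_integral_eq_of_pseudoEMetric_complete_countable
    laurentAlgebra_separatesPoints ?_
  rintro g ⟨d, r, hg⟩
  simpa [polyInner, hg] using hp d r

theorem tendsto_polyInner {ι : Type*} {l : Filter ι} {P : ι → ProbabilityMeasure Circle}
    {ν : ProbabilityMeasure Circle} (h : Tendsto P l (𝓝 ν)) (p q : ℂ[X]) :
    Tendsto (fun i => polyInner (P i : Measure Circle) p q) l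
      (𝓝 (polyInner (ν : Measure Circle) p q)) :=
  (ProbabilityMeasure.tendsto_iff_forall_integral_rclike_tendsto ℂ).1 h
    (BoundedContinuousFunction.mkOfCompact ⟨fun z => conj (p.eval (z : ℂ)) * q.eval (z : ℂ),
      ((Complex.continuous_conj.comp (continuous_eval p))).mul (continuous_eval q)⟩)

/-- The Bernstein–Szegő measures, as points of the space of probability measures. -/
noncomputable def bernsteinSzegoProb (α : ℕ → 𝔻) (n : ℕ) : ProbabilityMeasure Circle :=
  ⟨bernsteinSzego α n, inferInstance⟩

/-- The moments of order at most `n` are the same for all Bernstein–Szegő measures of index at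
least `n`, so by compactness these measures converge weakly. -/
theorem exists_tendsto_bernsteinSzego (α : ℕ → 𝔻) :
    ∃ ν : ProbabilityMeasure Circle, Tendsto (bernsteinSzegoProb α) atTop (𝓝 ν) := by
  have hev : ∀ k : ℕ, ∀ᶠ n in atTop, polyInner (bernsteinSzegoProb α n : Measure Circle) 1 (X ^ k) =
      polyInner (bernsteinSzego α k) 1 (X ^ k) := by
    intro k
    filter_upwards [eventually_ge_atTop k] with n hn
    exact ((isOrth_bernsteinSzego α n).mono hn).polyInner_one_eq (isOrth_bernsteinSzego α k) _
      (by simp)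
  have hcl : ∀ ν : ProbabilityMeasure Circle, MapClusterPt ν atTop (bernsteinSzegoProb α) →
      ∀ k, polyInner (ν : Measure Circle) 1 (X ^ k) =
        polyInner (bernsteinSzego α k) 1 (X ^ k) := by
    intro ν hν k
    have h1 := hν.continuousAt_comp
      (f := fun ν : ProbabilityMeasure Circle => polyInner (ν : Measure Circle) 1 (X ^ k))
      (tendsto_polyInner tendsto_id 1 (X ^ k))
    by_contra hne
    have h2 := h1.frequently (isOpen_ne.mem_nhds hne)
    obtain ⟨n, hn, hn'⟩ := (h2.and_eventually (hev k)).exists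
    exact hn hn'
  obtain ⟨ν, hν⟩ := exists_clusterPt_of_compactSpace (map (bernsteinSzegoProb α) atTop)
  refine ⟨ν, le_nhds_of_unique_clusterPt fun ν' hν' => ?_⟩
  refine ProbabilityMeasure.toMeasure_injective (measure_ext_of_polyInner_one fun k => ?_)
  exact (hcl ν' hν' k).trans (hcl ν hν k).symm

/-- The weak limit of the Bernstein–Szegő measures of `α`. -/
noncomputable def limitMeasure (α : ℕ → 𝔻) : ProbabilityMeasure Circle :=
  (exists_tendsto_bernsteinSzego α).choose

theorem tendsto_bernsteinSzego (α : ℕ → 𝔻) :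
    Tendsto (bernsteinSzegoProb α) atTop (𝓝 (limitMeasure α)) :=
  (exists_tendsto_bernsteinSzego α).choose_spec

theorem isOrth_limitMeasure (α : ℕ → 𝔻) (k : ℕ) :
    IsOrth (limitMeasure α : Measure Circle) α k := by
  intro j hj
  refine tendsto_nhds_unique (tendsto_polyInner (tendsto_bernsteinSzego α) _ _)
    (tendsto_const_nhds.congr' ?_)
  filter_upwards [eventually_ge_atTop k] with n hn
  exact (((isOrth_bernsteinSzego α n).mono hn) j hj).symm

/-! ### Gram–Schmidt -/

section GramSchmidt

variable {α : ℕ → 𝔻} {μ : Measure Circle} [IsProbabilityMeasure μ]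

theorem polyInner_szego_self (h : ∀ k, IsOrth μ α k) (n : ℕ) :
    polyInner μ (szego α n) (szego α n) = normProd α n := by
  rw [(h n).polyInner_self, polyInner_one_one, mul_one]

theorem polyInner_szego_of_ne (h : ∀ k, IsOrth μ α k) {m n : ℕ} (hmn : m ≠ n) :
    polyInner μ (szego α m) (szego α n) = 0 := by
  have hd : ∀ {i j : ℕ}, i < j → (szego α i).degree < (j : WithBot ℕ) := fun {i j} hij =>
    lt_of_le_of_lt degree_le_natDegree (by rw [natDegree_szego]; exact_mod_cast hij)
  rcases hmn.lt_or_gt with h' | h'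
  · exact (h n).szego_right (hd h')
  · exact (h m).szego_left (hd h')

/-- Expansion of a polynomial of degree less than `n` in the orthogonal basis `Φ_0, …, Φ_{n-1}`. -/
theorem eq_sum_szego (h : ∀ k, IsOrth μ α k) (n : ℕ) (p : ℂ[X])
    (hp : p.degree < (n : WithBot ℕ)) :
    p = ∑ k : Fin n, C (polyInner μ (szego α k) p / normProd α k) * szego α k := by
  induction n generalizing p with
  | zero => simpa using hp
  | succ n ih =>
    have hle : p.natDegree ≤ n := by
      rcases eq_or_ne p 0 with rfl | h0
      · simp
      · exact Nat.lt_succ_iff.1 ((natDegree_lt_iff_degree_lt h0).2 hp)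
    set c := p.coeff n with hc
    set q := p - C c * szego α n with hq
    have hqd : q.degree < (n : WithBot ℕ) := by
      rw [degree_lt_iff_coeff_zero]
      intro N hN
      rw [hq, coeff_sub, coeff_C_mul]
      rcases hN.eq_or_lt with rfl | hN'
      · have := (szego_monic α n).coeff_natDegree
        rw [natDegree_szego] at this
        simp [this, hc]
      · rw [coeff_eq_zero_of_natDegree_lt (lt_of_le_of_lt hle hN'),
          coeff_eq_zero_of_natDegree_lt (by rwa [natDegree_szego]), mul_zero, sub_zero]
    have hpq : p = q + C c * szego α n := by rw [hq]; ring
    have h0 : (normProd α n : ℂ) ≠ 0 := Complex.ofReal_ne_zero.2 (normProd_pos α n).ne'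
    have hlow : ∀ k : Fin n, polyInner μ (szego α k) p = polyInner μ (szego α k) q := by
      intro k
      rw [hpq, polyInner_add_right, polyInner_C_mul_right,
        polyInner_szego_of_ne h k.2.ne, mul_zero, add_zero]
    have htop : polyInner μ (szego α n) p = c * normProd α n := by
      rw [hpq, polyInner_add_right, polyInner_C_mul_right, polyInner_szego_self h,
        (h n).szego_left hqd, zero_add]
    rw [Fin.sum_univ_castSucc]
    simp only [Fin.val_castSucc, Fin.val_last, hlow, htop]
    rw [← ih q hqd, mul_div_assoc, div_self h0, mul_one, ← hpq]

/-- Polynomials satisfying the Szegő recursion that are orthogonal are the Gram–Schmidt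
polynomials. -/
theorem monicOP_eq_szego (h : ∀ k, IsOrth μ α k) (n : ℕ) : monicOP μ n = szego α n := by
  induction n using Nat.strong_induction_on with
  | _ n ih =>
    rw [monicOP]
    have hd : (X ^ n - szego α n).degree < (n : WithBot ℕ) := by
      have hX : (X ^ n : ℂ[X]).degree = (szego α n).degree := by
        rw [degree_X_pow, degree_eq_natDegree (szego_monic α n).ne_zero, natDegree_szego]
      have := degree_sub_lt_left hX (pow_ne_zero n X_ne_zero)
        (by rw [(szego_monic α n).leadingCoeff, leadingCoeff_X_pow])
      rwa [degree_X_pow] at this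
    have hs := eq_sum_szego h n _ hd
    have : ∑ k : Fin n, C (polyInner μ (monicOP μ k) (X ^ n) /
        polyInner μ (monicOP μ k) (monicOP μ k)) * monicOP μ k = X ^ n - szego α n := by
      rw [hs]
      refine Finset.sum_congr rfl fun k _ => ?_
      rw [ih k k.2, polyInner_szego_self h, polyInner_sub_right,
        polyInner_szego_of_ne h k.2.ne, sub_zero]
    rw [this, sub_sub_cancel]

theorem inv_norm_normalizedOP_sq (h : ∀ k, IsOrth μ α k) (n : ℕ) (z : Circle) :
    (‖(normalizedOP μ n).eval (z : ℂ)‖ ^ 2)⁻¹ = bsDensity α n z := by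
  have hn : ∫ z : Circle, ‖(szego α n).eval (z : ℂ)‖ ^ 2 ∂μ = normProd α n := by
    have := polyInner_szego_self h n
    simp only [polyInner, mul_comm, Complex.mul_conj'] at this
    apply Complex.ofReal_injective
    rw [← this, ← integral_complex_ofReal]
    push_cast
    rfl
  rw [normalizedOP, monicOP_eq_szego h, hn, eval_mul, eval_C, norm_mul, Complex.norm_real, mul_pow,
    norm_inv, inv_pow, Real.norm_of_nonneg (Real.sqrt_nonneg _),
    Real.sq_sqrt (normProd_pos α n).le, mul_inv, inv_inv, bsDensity, div_eq_mul_inv]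

end GramSchmidt

/-! ### The CMV basis -/

section CMVBasis

variable (α : ℕ → 𝔻)

theorem rho_pos (a : 𝔻) : 0 < rho a := Real.sqrt_pos.2 (one_sub_sq_pos a)

theorem sqrt_normProd_succ (n : ℕ) : √(normProd α (n + 1)) = √(normProd α n) * rho (α n) := by
  rw [normProd_succ, Real.sqrt_mul (normProd_pos α n).le, rho]

/-- The CMV basis: `χ_{2k} = z^{-k} φ_{2k}^*` and `χ_{2k+1} = z^{-k} φ_{2k+1}`. -/
noncomputable def cmvBasis (j : ℕ) : C(Circle, ℂ) where
  toFun z := conj (z : ℂ) ^ (j / 2) *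
    ((if Even j then szegoStar α j else szego α j).eval (z : ℂ) / √(normProd α j))
  continuous_toFun := ((Complex.continuous_conj.comp continuous_induced_dom).pow _).mul
    ((continuous_eval _).div_const _)

/-- The alternate CMV basis: `x_{2k} = z^{-k} φ_{2k}` and `x_{2k-1} = z^{-k} φ_{2k-1}^*`. -/
noncomputable def cmvAltBasis (j : ℕ) : C(Circle, ℂ) where
  toFun z := conj (z : ℂ) ^ ((j + 1) / 2) *
    ((if Even j then szego α j else szegoStar α j).eval (z : ℂ) / √(normProd α j))
  continuous_toFun := ((Complex.continuous_conj.comp continuous_induced_dom).pow _).mul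
    ((continuous_eval _).div_const _)

theorem cmvBasis_two_mul (k : ℕ) (z : Circle) : cmvBasis α (2 * k) z =
    conj (z : ℂ) ^ k * ((szegoStar α (2 * k)).eval (z : ℂ) / √(normProd α (2 * k))) := by
  simp [cmvBasis]

theorem cmvBasis_two_mul_add_one (k : ℕ) (z : Circle) : cmvBasis α (2 * k + 1) z =
    conj (z : ℂ) ^ k * ((szego α (2 * k + 1)).eval (z : ℂ) / √(normProd α (2 * k + 1))) := by
  simp [cmvBasis, show (2 * k + 1) / 2 = k by omega]

theorem cmvAltBasis_two_mul (k : ℕ) (z : Circle) : cmvAltBasis α (2 * k) z =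
    conj (z : ℂ) ^ k * ((szego α (2 * k)).eval (z : ℂ) / √(normProd α (2 * k))) := by
  simp [cmvAltBasis, show (2 * k + 1) / 2 = k by omega]

theorem cmvAltBasis_two_mul_add_one (k : ℕ) (z : Circle) : cmvAltBasis α (2 * k + 1) z =
    conj (z : ℂ) ^ (k + 1) *
      ((szegoStar α (2 * k + 1)).eval (z : ℂ) / √(normProd α (2 * k + 1))) := by
  simp [cmvAltBasis, show (2 * k + 1 + 1) / 2 = k + 1 by omega]

theorem sqrt_normProd_ne_zero (n : ℕ) : ((√(normProd α n) : ℝ) : ℂ) ≠ 0 :=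
  Complex.ofReal_ne_zero.2 (Real.sqrt_pos.2 (normProd_pos α n)).ne'

/-- The Szegő recursion for the normalized polynomials, solved for `z φ_n`. -/
theorem szego_normalized (n : ℕ) (z : ℂ) :
    conj (α n : ℂ) * ((szegoStar α n).eval z / √(normProd α n)) +
      rho (α n) * ((szego α (n + 1)).eval z / √(normProd α (n + 1))) =
    z * ((szego α n).eval z / √(normProd α n)) := by
  have h0 := sqrt_normProd_ne_zero α n
  have h1 : (rho (α n) : ℂ) ≠ 0 := Complex.ofReal_ne_zero.2 (rho_pos _).ne'
  rw [sqrt_normProd_succ, szego_succ]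
  simp only [eval_sub, eval_mul, eval_X, eval_C]
  push_cast
  field_simp
  ring

/-- The normalized Szegő recursion for the reversed polynomials. -/
theorem szegoStar_normalized (n : ℕ) (z : ℂ) :
    rho (α n) * ((szegoStar α n).eval z / √(normProd α n)) -
      (α n : ℂ) * ((szego α (n + 1)).eval z / √(normProd α (n + 1))) =
    (szegoStar α (n + 1)).eval z / √(normProd α (n + 1)) := by
  have h0 := sqrt_normProd_ne_zero α n
  have h1 : (rho (α n) : ℂ) ≠ 0 := Complex.ofReal_ne_zero.2 (rho_pos _).ne'
  rw [sqrt_normProd_succ, szego_succ, szegoStar_succ]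
  simp only [eval_sub, eval_mul, eval_X, eval_C]
  push_cast
  field_simp
  linear_combination (szegoStar α n).eval z * rho_sq (α n)

theorem cmvBasis_zero (z : Circle) : cmvBasis α 0 z = 1 := by
  simp [cmvBasis, normProd]

/-- `𝓛` carries the CMV basis to `z` times the alternate basis (even rows). -/
theorem actL_even_relation (k : ℕ) (z : Circle) :
    conj (α (2 * k) : ℂ) * cmvBasis α (2 * k) z + rho (α (2 * k)) * cmvBasis α (2 * k + 1) z =
      z * cmvAltBasis α (2 * k) z := by
  rw [cmvBasis_two_mul, cmvBasis_two_mul_add_one, cmvAltBasis_two_mul]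
  linear_combination conj (z : ℂ) ^ k * szego_normalized α (2 * k) z

/-- `𝓛` carries the CMV basis to `z` times the alternate basis (odd rows). -/
theorem actL_odd_relation (k : ℕ) (z : Circle) :
    rho (α (2 * k)) * cmvBasis α (2 * k) z - (α (2 * k) : ℂ) * cmvBasis α (2 * k + 1) z =
      z * cmvAltBasis α (2 * k + 1) z := by
  rw [cmvBasis_two_mul, cmvBasis_two_mul_add_one, cmvAltBasis_two_mul_add_one, pow_succ]
  linear_combination conj (z : ℂ) ^ k * szegoStar_normalized α (2 * k) z -
    conj (z : ℂ) ^ k * ((szegoStar α (2 * k + 1)).eval (z : ℂ) / √(normProd α (2 * k + 1))) *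
      conj_mul_self z

/-- `𝓜` carries the alternate basis to the CMV basis (odd rows). -/
theorem actM_odd_relation (k : ℕ) (z : Circle) :
    conj (α (2 * k + 1) : ℂ) * cmvAltBasis α (2 * k + 1) z +
      rho (α (2 * k + 1)) * cmvAltBasis α (2 * (k + 1)) z = cmvBasis α (2 * k + 1) z := by
  rw [cmvBasis_two_mul_add_one, cmvAltBasis_two_mul_add_one, cmvAltBasis_two_mul, pow_succ]
  linear_combination conj (z : ℂ) ^ k * conj (z : ℂ) * szego_normalized α (2 * k + 1) z +
    conj (z : ℂ) ^ k * ((szego α (2 * k + 1)).eval (z : ℂ) / √(normProd α (2 * k + 1))) *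
      conj_mul_self z

/-- `𝓜` carries the alternate basis to the CMV basis (even rows). -/
theorem actM_even_relation (k : ℕ) (z : Circle) :
    rho (α (2 * k + 1)) * cmvAltBasis α (2 * k + 1) z -
      (α (2 * k + 1) : ℂ) * cmvAltBasis α (2 * (k + 1)) z = cmvBasis α (2 * (k + 1)) z := by
  rw [cmvBasis_two_mul, cmvAltBasis_two_mul_add_one, cmvAltBasis_two_mul]
  linear_combination conj (z : ℂ) ^ (k + 1) * szegoStar_normalized α (2 * k + 1) z

end CMVBasis

section Orthonormal

variable {α : ℕ → 𝔻} {μ : Measure Circle} [IsProbabilityMeasure μ]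

theorem IsOrth.szegoStar_right {k : ℕ} (h : IsOrth μ α k) {q : ℂ[X]} (hq : q.natDegree < k) :
    polyInner μ (X * q) (szegoStar α k) = 0 := by
  rw [← conj_polyInner, q.as_sum_range_C_mul_X_pow' hq, Finset.mul_sum, polyInner_sum_right,
    Finset.sum_eq_zero, map_zero]
  intro j hj
  rw [mul_left_comm, polyInner_C_mul_right, ← pow_succ', ← conj_polyInner,
    h.polyInner_szegoStar_eq_zero (by omega) (Finset.mem_range.1 hj), map_zero, mul_zero]

theorem integral_cmvBasis_self (h : ∀ k, IsOrth μ α k) (j : ℕ) :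
    ∫ z, cmvBasis α j z * conj (cmvBasis α j z) ∂μ = 1 := by
  have key : ∀ p : ℂ[X], polyInner μ p p = normProd α j →
      ∫ z : Circle, (conj (z : ℂ) ^ (j / 2) * (p.eval (z : ℂ) / √(normProd α j))) *
        conj (conj (z : ℂ) ^ (j / 2) * (p.eval (z : ℂ) / √(normProd α j))) ∂μ = 1 := by
    intro p hp
    have h0 : (normProd α j : ℂ) ≠ 0 := Complex.ofReal_ne_zero.2 (normProd_pos α j).ne'
    have hs : ((√(normProd α j) : ℝ) : ℂ) * √(normProd α j) = normProd α j := by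
      rw [← Complex.ofReal_mul, Real.mul_self_sqrt (normProd_pos α j).le]
    rw [← div_self h0]
    nth_rw 1 [← hp]
    rw [polyInner, ← integral_div]
    congr 1; ext z
    have hz : conj (z : ℂ) ^ (j / 2) * (z : ℂ) ^ (j / 2) = 1 := by
      rw [← mul_pow, conj_mul_self, one_pow]
    have := sqrt_normProd_ne_zero α j
    rw [← hs]
    simp only [map_mul, map_pow, map_div₀, Complex.conj_conj, Complex.conj_ofReal]
    field_simp
    linear_combination p.eval (z : ℂ) * conj (p.eval (z : ℂ)) * hz
  by_cases hj : Even j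
  · simpa [cmvBasis, hj] using
      key _ ((polyInner_szegoStar_self j).trans (polyInner_szego_self h j))
  · simpa [cmvBasis, hj] using key _ (polyInner_szego_self h j)

/-- For `i < j`, `conj (χ_i) χ_j` is a multiple of `conj (z^{⌊j/2⌋-⌊i/2⌋} p) Φ` with `p` of degree at
most `i` and `Φ` either `Φ_j` or `Φ_j^*`. -/
theorem integral_cmvBasis_of_lt (h : ∀ k, IsOrth μ α k) {i j : ℕ} (hij : i < j) :
    ∫ z, cmvBasis α j z * conj (cmvBasis α i z) ∂μ = 0 := by
  have key : ∀ p q : ℂ[X], polyInner μ (X ^ (j / 2 - i / 2) * p) q = 0 →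
      ∫ z : Circle, (conj (z : ℂ) ^ (j / 2) * (q.eval (z : ℂ) / √(normProd α j))) *
        conj (conj (z : ℂ) ^ (i / 2) * (p.eval (z : ℂ) / √(normProd α i))) ∂μ = 0 := by
    intro p q hpq
    have : ∀ z : Circle, (conj (z : ℂ) ^ (j / 2) * (q.eval (z : ℂ) / √(normProd α j))) *
        conj (conj (z : ℂ) ^ (i / 2) * (p.eval (z : ℂ) / √(normProd α i))) =
        ((√(normProd α j) : ℂ)⁻¹ * (√(normProd α i) : ℂ)⁻¹) *
          (conj ((X ^ (j / 2 - i / 2) * p).eval (z : ℂ)) * q.eval (z : ℂ)) := by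
      intro z
      have hz : conj (z : ℂ) ^ (i / 2) * (z : ℂ) ^ (i / 2) = 1 := by
        rw [← mul_pow, conj_mul_self, one_pow]
      have hj :
          conj (z : ℂ) ^ (j / 2) = conj (z : ℂ) ^ (j / 2 - i / 2) * conj (z : ℂ) ^ (i / 2) := by
        rw [← pow_add]; congr 1; omega
      rw [hj]
      simp only [map_mul, map_pow, map_div₀, Complex.conj_conj, Complex.conj_ofReal, eval_mul,
        eval_pow, eval_X]
      linear_combination conj (z : ℂ) ^ (j / 2 - i / 2) * q.eval (z : ℂ) * conj (p.eval (z : ℂ)) *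
        ((√(normProd α j) : ℂ)⁻¹ * (√(normProd α i) : ℂ)⁻¹) * hz
    simp only [this, integral_const_mul]
    rw [← polyInner, hpq, mul_zero]
  have hp : (if Even i then szegoStar α i else szego α i).natDegree ≤ i := by
    split_ifs
    · exact natDegree_szegoStar_le α i
    · exact (natDegree_szego α i).le
  refine key _ _ ?_
  generalize (if Even i then szegoStar α i else szego α i) = p at hp
  have hXp : ∀ m, (X ^ m * p).natDegree ≤ m + i := fun m =>
    (natDegree_mul_le).trans (add_le_add (natDegree_X_pow m).le hp)
  split_ifs with hj
  · obtain ⟨m, rfl⟩ := hj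
    obtain ⟨d, hd⟩ : ∃ d, (m + m) / 2 - i / 2 = d + 1 := ⟨(m + m) / 2 - i / 2 - 1, by omega⟩
    rw [hd, pow_succ', mul_assoc]
    exact (h _).szegoStar_right (lt_of_le_of_lt (hXp d) (by omega))
  · rw [Nat.not_even_iff_odd] at hj
    obtain ⟨m, rfl⟩ := hj
    refine (h _).szego_right (lt_of_le_of_lt degree_le_natDegree ?_)
    exact_mod_cast lt_of_le_of_lt (hXp _) (by omega)

theorem orthonormal_cmvBasis (h : ∀ k, IsOrth μ α k) :
    Orthonormal ℂ fun j => ContinuousMap.toLp 2 μ ℂ (cmvBasis α j) := by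
  rw [orthonormal_iff_ite]
  intro i j
  rw [ContinuousMap.inner_toLp]
  rcases lt_trichotomy i j with hij | rfl | hij
  · rw [if_neg hij.ne, integral_cmvBasis_of_lt h hij]
  · rw [if_pos rfl, integral_cmvBasis_self h]
  · rw [if_neg hij.ne', ← Complex.conj_conj (∫ z, _ ∂μ), ← integral_conj]
    simp only [map_mul, Complex.conj_conj, mul_comm]
    rw [integral_cmvBasis_of_lt h hij, map_zero]

end Orthonormal

/-! ### The spectral representation -/

/-- The standard basis vector `δ_j` of `ℓ²(ℕ)`. -/
noncomputable def delta (j : ℕ) : ℓ²(ℕ, ℂ) := lp.single 2 j 1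

theorem delta_apply (j i : ℕ) : delta j i = if i = j then 1 else 0 := by
  simp [delta, lp.single_apply, Pi.single_apply]

section Columns

variable (α : ℕ → 𝔻)

theorem opL_apply (x : ℓ²(ℕ, ℂ)) (i : ℕ) : opL α x i = actL α x i := rfl

theorem opM_apply (x : ℓ²(ℕ, ℂ)) (i : ℕ) : opM α x i = actM α x i := rfl

theorem opL_delta_even (k : ℕ) : opL α (delta (2 * k)) =
    conj (α (2 * k) : ℂ) • delta (2 * k) + (rho (α (2 * k)) : ℂ) • delta (2 * k + 1) := by
  ext i
  simp only [opL_apply, actL, Theta, lp.coeFn_add, lp.coeFn_smul, Pi.add_apply, Pi.smul_apply,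
    delta_apply, smul_eq_mul]
  rcases Nat.even_or_odd' i with ⟨l, rfl | rfl⟩
  · rcases eq_or_ne l k with rfl | h
    · simp
    · simp [h, show 2 * l + 1 ≠ 2 * k by omega, show 2 * l ≠ 2 * k + 1 by omega]
  · rcases eq_or_ne l k with rfl | h
    · simp
    · simp [h, show 2 * l + 1 ≠ 2 * k by omega]

theorem opL_delta_odd (k : ℕ) : opL α (delta (2 * k + 1)) =
    (rho (α (2 * k)) : ℂ) • delta (2 * k) - (α (2 * k) : ℂ) • delta (2 * k + 1) := by
  ext i
  simp only [opL_apply, actL, Theta, lp.coeFn_sub, lp.coeFn_smul, Pi.sub_apply, Pi.smul_apply,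
    delta_apply, smul_eq_mul]
  rcases Nat.even_or_odd' i with ⟨l, rfl | rfl⟩
  · rcases eq_or_ne l k with rfl | h
    · simp
    · simp [h, show 2 * l ≠ 2 * k + 1 by omega]
  · rcases eq_or_ne l k with rfl | h
    · simp
    · simp [h, show 2 * l + 1 ≠ 2 * k by omega, show 2 * l ≠ 2 * k + 1 by omega]

theorem opM_delta_zero : opM α (delta 0) = delta 0 := by
  ext i
  simp only [opM_apply, actM, Theta, delta_apply]
  rcases i with _ | i
  · simp
  · rcases Nat.even_or_odd' i with ⟨l, rfl | rfl⟩
    · simp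
    · simp [show ¬ Odd (2 * l + 1 + 1) by rw [Nat.not_odd_iff_even]; exact ⟨l + 1, by ring⟩]

theorem opM_delta_odd (k : ℕ) : opM α (delta (2 * k + 1)) =
    conj (α (2 * k + 1) : ℂ) • delta (2 * k + 1) +
      (rho (α (2 * k + 1)) : ℂ) • delta (2 * (k + 1)) := by
  ext i
  simp only [opM_apply, actM, Theta, lp.coeFn_add, lp.coeFn_smul, Pi.add_apply, Pi.smul_apply,
    delta_apply, smul_eq_mul]
  rcases i with _ | i
  · simp
  · rcases Nat.even_or_odd' i with ⟨l, rfl | rfl⟩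
    · rcases eq_or_ne l k with rfl | h
      · simp [show 2 * l + 1 ≠ 2 * (l + 1) by omega]
      · simp [h, show 2 * l + 1 ≠ 2 * (k + 1) by omega, show 2 * l + 1 ≠ 2 * k by omega]
    · have hodd : ¬ Odd (2 * l + 1 + 1) := by rw [Nat.not_odd_iff_even]; exact ⟨l + 1, by ring⟩
      rcases eq_or_ne l k with rfl | h
      · simp [hodd, show 2 * (l + 1) = 2 * l + 1 + 1 by ring]
      · simp [hodd, h, show 2 * l + 1 + 1 ≠ 2 * (k + 1) by omega, show 2 * l + 1 ≠ 2 * k by omega]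

theorem opM_delta_even (k : ℕ) : opM α (delta (2 * (k + 1))) =
    (rho (α (2 * k + 1)) : ℂ) • delta (2 * k + 1) -
      (α (2 * k + 1) : ℂ) • delta (2 * (k + 1)) := by
  ext i
  simp only [opM_apply, actM, Theta, lp.coeFn_sub, lp.coeFn_smul, Pi.sub_apply, Pi.smul_apply,
    delta_apply, smul_eq_mul]
  rcases i with _ | i
  · simp
  · rcases Nat.even_or_odd' i with ⟨l, rfl | rfl⟩
    · rcases eq_or_ne l k with rfl | h
      · simp [show 2 * l + 1 ≠ 2 * (l + 1) by omega, show 2 * l + 1 + 1 = 2 * (l + 1) by ring]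
      · simp [h, show 2 * l + 1 ≠ 2 * (k + 1) by omega, show 2 * l + 1 + 1 ≠ 2 * (k + 1) by omega]
    · have hodd : ¬ Odd (2 * l + 1 + 1) := by rw [Nat.not_odd_iff_even]; exact ⟨l + 1, by ring⟩
      rcases eq_or_ne l k with rfl | h
      · simp [hodd, show 2 * (l + 1) = 2 * l + 1 + 1 by ring]
      · simp [hodd, show 2 * l + 1 + 1 ≠ 2 * (k + 1) by omega,
          show 2 * l + 1 ≠ 2 * (k + 1) by omega, show 2 * l + 1 ≠ 2 * k by omega]

end Columns

section Representation

variable {α : ℕ → 𝔻} {μ : Measure Circle} [IsProbabilityMeasure μ]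

/-- The coordinate function `z` on the circle. -/
def circleCoord : C(Circle, ℂ) := ⟨fun z => (z : ℂ), continuous_induced_dom⟩

/-- Multiplication by `z` on `L²(μ)`. -/
noncomputable def mulCoord (μ : Measure Circle) [IsProbabilityMeasure μ] :
    Lp ℂ 2 μ →L[ℂ] Lp ℂ 2 μ :=
  (ContinuousLinearMap.mul ℂ ℂ).holderL μ ∞ 2 2 (ContinuousMap.toLp ∞ μ ℂ circleCoord)

theorem mulCoord_ae (f : Lp ℂ 2 μ) : (mulCoord μ f : Circle → ℂ) =ᵐ[μ] fun z => (z : ℂ) * f z := by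
  have h1 := (ContinuousLinearMap.mul ℂ ℂ).coeFn_holder (r := 2)
    (ContinuousMap.toLp ∞ μ ℂ circleCoord) f
  have h2 := ContinuousMap.coeFn_toLp (p := ∞) (𝕜 := ℂ) μ circleCoord
  filter_upwards [h1, h2] with z hz1 hz2
  refine hz1.trans ?_
  rw [hz2]
  rfl

theorem mulCoord_toLp (f : C(Circle, ℂ)) :
    mulCoord μ (ContinuousMap.toLp 2 μ ℂ f) = ContinuousMap.toLp 2 μ ℂ (circleCoord * f) := by
  apply Lp.ext
  filter_upwards [mulCoord_ae (ContinuousMap.toLp 2 μ ℂ f),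
    ContinuousMap.coeFn_toLp (p := 2) (𝕜 := ℂ) μ f,
    ContinuousMap.coeFn_toLp (p := 2) (𝕜 := ℂ) μ (circleCoord * f)] with z h1 h2 h3
  rw [h1, h2, h3]
  rfl

/-- The isometry `ℓ²(ℕ) → L²(μ)` sending `δ_j` to the CMV basis function `χ_j`. -/
noncomputable def cmvIsometry (h : ∀ k, IsOrth μ α k) : ℓ²(ℕ, ℂ) →ₗᵢ[ℂ] Lp ℂ 2 μ :=
  (orthonormal_cmvBasis h).orthogonalFamily.linearIsometry

theorem cmvIsometry_delta (h : ∀ k, IsOrth μ α k) (j : ℕ) :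
    cmvIsometry h (delta j) = ContinuousMap.toLp 2 μ ℂ (cmvBasis α j) := by
  rw [cmvIsometry, delta, OrthogonalFamily.linearIsometry_apply_single]
  simp

theorem cmvIsometry_opL_delta (h : ∀ k, IsOrth μ α k) (j : ℕ) :
    cmvIsometry h (opL α (delta j)) =
      ContinuousMap.toLp 2 μ ℂ (circleCoord * cmvAltBasis α j) := by
  rcases Nat.even_or_odd' j with ⟨k, rfl | rfl⟩
  · rw [opL_delta_even, map_add, map_smul, map_smul, cmvIsometry_delta, cmvIsometry_delta,
      ← map_smul, ← map_smul, ← map_add]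
    congr 1; ext z
    exact actL_even_relation α k z
  · rw [opL_delta_odd, map_sub, map_smul, map_smul, cmvIsometry_delta, cmvIsometry_delta,
      ← map_smul, ← map_smul, ← map_sub]
    congr 1; ext z
    exact actL_odd_relation α k z

theorem cmvIsometry_cmv_delta (h : ∀ k, IsOrth μ α k) (j : ℕ) :
    cmvIsometry h (cmv α (delta j)) = ContinuousMap.toLp 2 μ ℂ (circleCoord * cmvBasis α j) := by
  have hc : ∀ x, cmv α x = opL α (opM α x) := fun x => rfl
  rw [hc]
  rcases Nat.even_or_odd' j with ⟨k, rfl | rfl⟩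
  · rcases k with _ | k
    · rw [mul_zero, opM_delta_zero, cmvIsometry_opL_delta]
      congr 2
    · rw [opM_delta_even, map_sub, map_smul, map_smul, map_sub, map_smul, map_smul,
        cmvIsometry_opL_delta, cmvIsometry_opL_delta, ← map_smul, ← map_smul, ← map_sub]
      congr 1; ext z
      simp only [ContinuousMap.sub_apply, ContinuousMap.smul_apply, ContinuousMap.mul_apply,
        smul_eq_mul]
      rw [← actM_even_relation]
      ring
  · rw [opM_delta_odd, map_add, map_smul, map_smul, map_add, map_smul, map_smul,
      cmvIsometry_opL_delta, cmvIsometry_opL_delta, ← map_smul, ← map_smul, ← map_add]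
    congr 1; ext z
    simp only [ContinuousMap.add_apply, ContinuousMap.smul_apply, ContinuousMap.mul_apply,
      smul_eq_mul]
    rw [← actM_odd_relation]
    ring

theorem cmvIsometry_cmv (h : ∀ k, IsOrth μ α k) (x : ℓ²(ℕ, ℂ)) :
    cmvIsometry h (cmv α x) = mulCoord μ (cmvIsometry h x) := by
  have : (cmvIsometry h).toContinuousLinearMap ∘L
      (cmv α).toContinuousLinearEquiv.toContinuousLinearMap =
      mulCoord μ ∘L (cmvIsometry h).toContinuousLinearMap := by
    refine lp.ext_continuousLinearMap (by simp) fun j => ?_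
    refine ContinuousLinearMap.ext_ring ?_
    change cmvIsometry h (cmv α (delta j)) = mulCoord μ (cmvIsometry h (delta j))
    rw [cmvIsometry_cmv_delta, cmvIsometry_delta, mulCoord_toLp]
  exact DFunLike.congr_fun this x

/-- A measure for which the polynomials of the Szegő recursion are orthogonal is a spectral measure
of the CMV matrix. -/
theorem isSpectralMeasure_of_isOrth (h : ∀ k, IsOrth μ α k) :
    IsSpectralMeasure (cmv α) delta0 μ := by
  refine ⟨inferInstance, cmvIsometry h, fun x => ?_, ?_⟩
  · rw [cmvIsometry_cmv]
    exact mulCoord_ae _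
  · change (cmvIsometry h (delta 0) : Circle → ℂ) =ᵐ[μ] fun _ => 1
    rw [cmvIsometry_delta]
    filter_upwards [ContinuousMap.coeFn_toLp (p := 2) (𝕜 := ℂ) μ (cmvBasis α 0)] with z hz
    rw [hz, cmvBasis_zero]

end Representation

/-- The moments of a spectral measure are `⟪ζ, U^k ζ⟫`. -/
theorem IsSpectralMeasure.polyInner_one_X_pow {H : Type*} [NormedAddCommGroup H]
    [InnerProductSpace ℂ H] {U : H ≃ₗᵢ[ℂ] H} {ζ : H} {μ : Measure Circle}
    (h : IsSpectralMeasure U ζ μ) (k : ℕ) :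
    polyInner μ 1 (X ^ k) = inner ℂ ζ (U^[k] ζ) := by
  obtain ⟨_, V, hV, hζ⟩ := h
  have hk : (V (U^[k] ζ) : Circle → ℂ) =ᵐ[μ] fun z => (z : ℂ) ^ k := by
    induction k with
    | zero => simpa using hζ
    | succ k ih =>
      rw [Function.iterate_succ_apply']
      filter_upwards [hV (U^[k] ζ), ih] with z h1 h2
      rw [h1, h2, pow_succ']
  rw [← V.inner_map_map, L2.inner_def, polyInner]
  refine integral_congr_ae ?_
  filter_upwards [hk, hζ] with z h1 h2
  rw [h1, h2]
  simp

theorem IsSpectralMeasure.unique {H : Type*} [NormedAddCommGroup H]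
    [InnerProductSpace ℂ H] {U : H ≃ₗᵢ[ℂ] H} {ζ : H} {μ ν : Measure Circle}
    (hμ : IsSpectralMeasure U ζ μ) (hν : IsSpectralMeasure U ζ ν) : μ = ν := by
  have := hμ.1
  have := hν.1
  exact measure_ext_of_polyInner_one fun k => by
    rw [hμ.polyInner_one_X_pow, hν.polyInner_one_X_pow]

theorem isSpectralMeasure_limitMeasure (α : ℕ → 𝔻) :
    IsSpectralMeasure (cmv α) delta0 (limitMeasure α : Measure Circle) :=
  isSpectralMeasure_of_isOrth (isOrth_limitMeasure α)

theorem isSpectralMeasure_spectralMeasure (α : ℕ → 𝔻) :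
    IsSpectralMeasure (cmv α) delta0 (spectralMeasure α) := by
  have h : ∃ μ, IsSpectralMeasure (cmv α) delta0 μ := ⟨_, isSpectralMeasure_limitMeasure α⟩
  rw [spectralMeasure, dif_pos h]
  exact h.choose_spec

theorem spectralMeasure_eq (α : ℕ → 𝔻) : spectralMeasure α = limitMeasure α :=
  (isSpectralMeasure_spectralMeasure α).unique (isSpectralMeasure_limitMeasure α)

instance (α : ℕ → 𝔻) : IsProbabilityMeasure (spectralMeasure α) :=
  (isSpectralMeasure_spectralMeasure α).1

/-! ### Measurability of the spectral measure -/

theorem continuous_eval_szegoPair (n : ℕ) :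
    Continuous (fun p : (ℕ → 𝔻) × Circle => (szego p.1 n).eval (p.2 : ℂ)) ∧
      Continuous (fun p : (ℕ → 𝔻) × Circle => (szegoStar p.1 n).eval (p.2 : ℂ)) := by
  induction n with
  | zero => simp [continuous_const]
  | succ n ih =>
    have hz : Continuous fun p : (ℕ → 𝔻) × Circle => (p.2 : ℂ) :=
      continuous_induced_dom.comp continuous_snd
    have ha : Continuous fun p : (ℕ → 𝔻) × Circle => (p.1 n : ℂ) :=
      UnitDisc.continuous_coe.comp ((continuous_apply n).comp continuous_fst)
    simp only [szego_succ, szegoStar_succ, eval_sub, eval_mul, eval_X, eval_C]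
    exact ⟨(hz.mul ih.1).sub ((Complex.continuous_conj.comp ha).mul ih.2),
      ih.2.sub (ha.mul (hz.mul ih.1))⟩

theorem continuous_bsDensity_uncurry (n : ℕ) :
    Continuous fun p : (ℕ → 𝔻) × Circle => bsDensity p.1 n p.2 := by
  refine Continuous.div ?_ ((continuous_eval_szegoPair n).1.norm.pow 2) fun p => ?_
  · refine continuous_finsetProd _ fun k _ => continuous_const.sub (Continuous.pow ?_ 2)
    exact (UnitDisc.continuous_coe.comp ((continuous_apply k).comp continuous_fst)).norm
  · have := eval_szego_ne_zero p.1 n p.2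
    positivity

theorem measurable_ofReal_bsDensity (n : ℕ) :
    Measurable fun p : (ℕ → 𝔻) × Circle => ENNReal.ofReal (bsDensity p.1 n p.2) :=
  (continuous_bsDensity_uncurry n).measurable.ennreal_ofReal

theorem lintegral_bernsteinSzego (α : ℕ → 𝔻) (n : ℕ) {f : Circle → ℝ≥0∞} (hf : Measurable f) :
    ∫⁻ z, f z ∂(bernsteinSzego α n) =
      ∫⁻ z, ENNReal.ofReal (bsDensity α n z) * f z ∂lebesgueCircle :=
  lintegral_withDensity_eq_lintegral_mul _ (continuous_bsDensity α n).measurable.ennreal_ofReal hf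

theorem tendsto_lintegral_bernsteinSzego (α : ℕ → 𝔻) (f : Circle →ᵇ ℝ≥0) :
    Tendsto (fun n => ∫⁻ z, ENNReal.ofReal (bsDensity α n z) * f z ∂lebesgueCircle) atTop
      (𝓝 (∫⁻ z, f z ∂(spectralMeasure α))) := by
  rw [spectralMeasure_eq]
  have := ProbabilityMeasure.tendsto_iff_forall_lintegral_tendsto.1 (tendsto_bernsteinSzego α) f
  refine this.congr fun n => ?_
  exact lintegral_bernsteinSzego α n f.continuous.measurable.coe_nnreal_ennreal

theorem measurable_lintegral_bernsteinSzego (n : ℕ) (f : Circle →ᵇ ℝ≥0) :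
    Measurable fun α => ∫⁻ z, ENNReal.ofReal (bsDensity α n z) * f z ∂lebesgueCircle :=
  Measurable.lintegral_prod_right' (f := fun p : (ℕ → 𝔻) × Circle =>
    ENNReal.ofReal (bsDensity p.1 n p.2) * f p.2) ((measurable_ofReal_bsDensity n).mul
      (f.continuous.measurable.coe_nnreal_ennreal.comp measurable_snd))

theorem measurable_spectralMeasure : Measurable spectralMeasure := by
  refine Measurable.measure_of_isPiSystem_of_isProbabilityMeasure
    (BorelSpace.measurable_eq.trans borel_eq_generateFrom_isClosed) isPiSystem_isClosed ?_
  intro F hF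
  have hF : IsClosed F := hF
  refine measurable_of_tendsto_metrizable (fun n => ?_) (tendsto_pi_nhds.2 fun α =>
    HasOuterApproxClosed.tendsto_lintegral_apprSeq hF (spectralMeasure α))
  exact measurable_of_tendsto_metrizable
    (fun m => measurable_lintegral_bernsteinSzego m (hF.apprSeq n))
    (tendsto_pi_nhds.2 fun α => tendsto_lintegral_bernsteinSzego α (hF.apprSeq n))

/-! ### The Poisson kernel -/

/-- The Poisson kernel `(1 - |x|²) / |1 - x|²` at the boundary point `1`. -/
noncomputable def poissonOne (x : 𝔻) : ℝ := (1 - ‖(x : ℂ)‖ ^ 2) / ‖1 - (x : ℂ)‖ ^ 2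

theorem one_sub_coe_ne_zero (x : 𝔻) : (1 - x : ℂ) ≠ 0 := sub_ne_zero.2 x.coe_ne_one.symm

theorem one_sub_conj_ne_zero (x : 𝔻) : (1 - conj (x : ℂ)) ≠ 0 := by
  rw [← map_one (starRingEnd ℂ), ← map_sub]
  exact (_root_.map_ne_zero _).2 (one_sub_coe_ne_zero x)

theorem continuous_poissonOne : Continuous poissonOne :=
  (continuous_const.sub (UnitDisc.continuous_coe.norm.pow 2)).div
    ((continuous_const.sub UnitDisc.continuous_coe).norm.pow 2) fun x => by
      have := one_sub_coe_ne_zero x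
      positivity

theorem measurable_ofReal_poissonOne : Measurable fun x => ENNReal.ofReal (poissonOne x) :=
  continuous_poissonOne.measurable.ennreal_ofReal

theorem continuous_circle_smul : Continuous fun p : Circle × 𝔻 => p.1 • p.2 := by
  have h : Continuous fun p : Circle × 𝔻 => (p.1 : ℂ) :=
    continuous_induced_dom.comp continuous_fst
  exact UnitDisc.isEmbedding_coe.continuous_iff.2
    (h.mul (UnitDisc.continuous_coe.comp continuous_snd))

theorem measurable_const_circle_smul (c : Circle) : Measurable fun x : 𝔻 => c • x := by
  have h : Continuous fun x : 𝔻 => (c, x) := continuous_const.prodMk continuous_id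
  exact (continuous_circle_smul.comp h).measurable

/-- If `Φ_n^*(z) = w z Φ_n(z)`, then passing from `n` to `n + 1` multiplies the density
`|φ_n(z)|^{-2}` by the Poisson kernel of `w⁻¹ α_n`. -/
theorem bsDensity_succ {α : ℕ → 𝔻} {n : ℕ} {z w : Circle} {x : 𝔻} (hx : α n = w • x)
    (hw : (szegoStar α n).eval (z : ℂ) = w * (z * (szego α n).eval (z : ℂ))) :
    bsDensity α (n + 1) z = bsDensity α n z * poissonOne x := by
  have h1 : (szego α (n + 1)).eval (z : ℂ) =
      z * (szego α n).eval (z : ℂ) * (1 - conj (x : ℂ)) := by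
    rw [szego_succ]
    simp only [eval_sub, eval_mul, eval_X, eval_C, hw, hx, UnitDisc.coe_circle_smul, map_mul]
    linear_combination -conj (x : ℂ) * (z * (szego α n).eval (z : ℂ)) * conj_mul_self w
  have h2 : ‖1 - conj (x : ℂ)‖ = ‖1 - (x : ℂ)‖ := by
    rw [← Complex.norm_conj]; simp
  have h3 : ‖(α n : ℂ)‖ = ‖(x : ℂ)‖ := by
    rw [hx, UnitDisc.coe_circle_smul, norm_mul, Circle.norm_coe, one_mul]
  rw [bsDensity, bsDensity, poissonOne, h1, normProd_succ, norm_mul, norm_mul, Circle.norm_coe,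
    one_mul, h2, h3, mul_pow, div_mul_div_comm]

/-- The mean of the Poisson kernel over a circle is the total mass of a Bernstein–Szegő measure. -/
theorem lintegral_poissonOne_smul (x : 𝔻) :
    ∫⁻ c : Circle, ENNReal.ofReal (poissonOne (c • x)) ∂lebesgueCircle = 1 := by
  have h := measure_univ (μ := bernsteinSzego (fun _ => x) 1)
  rw [bernsteinSzego, withDensity_apply _ MeasurableSet.univ, Measure.restrict_univ] at h
  rw [← h]
  congr 1; ext c
  rw [bsDensity_succ (x := c • x) (w := c⁻¹) (by rw [inv_smul_smul]) (by simp)]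
  simp [bsDensity, normProd]

theorem lintegral_poissonOne {ν : Measure 𝔻} [IsProbabilityMeasure ν]
    (hν : ∀ c : Circle, ν.map (fun x => c • x) = ν) :
    ∫⁻ x, ENNReal.ofReal (poissonOne x) ∂ν = 1 := by
  have h1 : ∀ c : Circle, ∫⁻ x, ENNReal.ofReal (poissonOne (c • x)) ∂ν =
      ∫⁻ x, ENNReal.ofReal (poissonOne x) ∂ν := by
    intro c
    nth_rw 2 [← hν c]
    rw [lintegral_map measurable_ofReal_poissonOne (measurable_const_circle_smul c)]
  have h2 : ∫⁻ c : Circle, ∫⁻ x, ENNReal.ofReal (poissonOne (c • x)) ∂ν ∂lebesgueCircle =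
      ∫⁻ x, ENNReal.ofReal (poissonOne x) ∂ν := by
    simp [h1]
  rw [← h2, lintegral_lintegral_swap]
  · simp [lintegral_poissonOne_smul]
  · exact (measurable_ofReal_poissonOne.comp continuous_circle_smul.measurable).aemeasurable

/-! ### The rotated coefficients -/

/-- The point `(1 - x) / (1 - conj x)` of the circle. -/
noncomputable def phase (x : 𝔻) : Circle :=
  Circle.ofConjDivSelf (1 - conj (x : ℂ)) (one_sub_conj_ne_zero x)

theorem coe_phase (x : 𝔻) : (phase x : ℂ) = (1 - x) / (1 - conj (x : ℂ)) := by
  simp [phase]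

theorem continuous_phase : Continuous phase := by
  refine continuous_induced_rng.2 (((continuous_const.sub UnitDisc.continuous_coe).div
    (continuous_const.sub (Complex.continuous_conj.comp UnitDisc.continuous_coe))
    one_sub_conj_ne_zero).congr fun x => (coe_phase x).symm)

/-- The rotation `z^{-(n+1)} ∏_{k<n} (1 - β_k) / (1 - conj β_k)`. -/
noncomputable def rotation (z : Circle) (β : ℕ → 𝔻) (n : ℕ) : Circle :=
  z⁻¹ ^ (n + 1) * ∏ k ∈ Finset.range n, phase (β k)

/-- The sequence obtained from `β` by rotating `β_n` by an angle depending on `z` and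
`β_0, …, β_{n-1}`, so that `|φ_n(z)|^{-2}` becomes a product of functions of the single `β_k`. -/
noncomputable def rotate (z : Circle) (β : ℕ → 𝔻) (n : ℕ) : 𝔻 := rotation z β n • β n

theorem rotation_succ (z : Circle) (β : ℕ → 𝔻) (n : ℕ) :
    rotation z β (n + 1) = z⁻¹ * rotation z β n * phase (β n) := by
  rw [rotation, rotation, Finset.prod_range_succ, pow_succ' z⁻¹ (n + 1)]
  simp only [mul_assoc]

theorem rotation_congr {z : Circle} {β β' : ℕ → 𝔻} {n : ℕ} (h : ∀ k < n, β k = β' k) :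
    rotation z β n = rotation z β' n := by
  rw [rotation, rotation,
    Finset.prod_congr rfl fun k hk => by rw [h k (Finset.mem_range.1 hk)]]

theorem rotate_congr {z : Circle} {β β' : ℕ → 𝔻} {n : ℕ} (h : ∀ k ≤ n, β k = β' k) :
    rotate z β n = rotate z β' n := by
  rw [rotate, rotate, rotation_congr fun k hk => h k hk.le, h n le_rfl]

theorem continuous_rotate : Continuous fun p : Circle × (ℕ → 𝔻) => rotate p.1 p.2 := by
  refine continuous_pi fun n => continuous_circle_smul.comp (Continuous.prodMk ?_
    ((continuous_apply n).comp continuous_snd))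
  exact ((continuous_fst.inv).pow _).mul (continuous_finsetProd _ fun k _ =>
    continuous_phase.comp ((continuous_apply k).comp continuous_snd))

theorem measurable_rotate (z : Circle) : Measurable (rotate z) :=
  (continuous_rotate.comp (Continuous.prodMk_right z)).measurable

/-- The rotations are the ratios `Φ_n^*(z) / (z Φ_n(z))` for the rotated sequence. -/
theorem szegoStar_rotate (z : Circle) (β : ℕ → 𝔻) (n : ℕ) :
    (szegoStar (rotate z β) n).eval (z : ℂ) =
      rotation z β n * (z * (szego (rotate z β) n).eval (z : ℂ)) := by
  induction n with
  | zero => simp [rotation]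
  | succ n ih =>
    have h1 : (szego (rotate z β) (n + 1)).eval (z : ℂ) =
        z * (szego (rotate z β) n).eval (z : ℂ) * (1 - conj (β n : ℂ)) := by
      rw [szego_succ]
      simp only [eval_sub, eval_mul, eval_X, eval_C, ih, rotate, UnitDisc.coe_circle_smul, map_mul]
      linear_combination -conj (β n : ℂ) * (z * (szego (rotate z β) n).eval (z : ℂ)) *
        conj_mul_self (rotation z β n)
    rw [h1, szegoStar_succ, rotation_succ]
    simp only [eval_sub, eval_mul, eval_X, eval_C, ih, Circle.coe_mul, Circle.coe_inv, coe_phase]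
    have h2 := one_sub_conj_ne_zero (β n)
    have h3 := z.coe_ne_zero
    have h4 : (rotate z β n : ℂ) = rotation z β n * β n := UnitDisc.coe_circle_smul _ _
    rw [h4]
    field_simp

theorem szegoPair_congr {α α' : ℕ → 𝔻} {n : ℕ} (h : ∀ k < n, α k = α' k) :
    szegoPair α n = szegoPair α' n := by
  induction n with
  | zero => rfl
  | succ n ih =>
    rw [szegoPair, szegoPair, ih fun k hk => h k (hk.trans n.lt_succ_self), h n n.lt_succ_self]

theorem bsDensity_congr {α α' : ℕ → 𝔻} {n : ℕ} (h : ∀ k < n, α k = α' k) (z : Circle) :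
    bsDensity α n z = bsDensity α' n z := by
  rw [bsDensity, bsDensity, szego, szego, szegoPair_congr h, normProd, normProd,
    Finset.prod_congr rfl fun k hk => by rw [h k (Finset.mem_range.1 hk)]]

/-! ### The law of the rotated coefficients -/

/-- Integrating a function of the first `n + 1` coordinates of an independent sequence: the last
coordinate may be integrated out separately. -/
theorem lintegral_eq_lintegral_update {P : Measure (ℕ → 𝔻)} [IsProbabilityMeasure P]
    (hP : iIndepFun (fun (k : ℕ) (α : ℕ → 𝔻) => α k) P) {n : ℕ} {f : (ℕ → 𝔻) → ℝ≥0∞}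
    (hf : Measurable f) (hdep : DependsOn f (Set.Iio (n + 1))) :
    ∫⁻ α, f α ∂P = ∫⁻ α, ∫⁻ x, f (Function.update α n x) ∂(P.map fun α => α n) ∂P := by
  let r : (ℕ → 𝔻) → (Finset.range n → 𝔻) := fun α k => α k
  let F : (Finset.range n → 𝔻) × 𝔻 → ℝ≥0∞ :=
    fun p => f fun k => if h : k ∈ Finset.range n then p.1 ⟨k, h⟩ else p.2
  have hr : Measurable r := measurable_pi_lambda _ fun k => measurable_pi_apply _
  have hn : Measurable fun α : ℕ → 𝔻 => α n := measurable_pi_apply n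
  have hF : Measurable F := by
    refine hf.comp (measurable_pi_lambda _ fun k => ?_)
    by_cases h : k ∈ Finset.range n
    · simpa [h, Function.comp_def] using
        (measurable_pi_apply (⟨k, h⟩ : Finset.range n)).comp measurable_fst
    · simpa [h] using measurable_snd
  have hind : IndepFun r (fun α : ℕ → 𝔻 => α n) P := by
    have := hP.indepFun_finset (Finset.range n) {n} (by simp) fun k => measurable_pi_apply k
    exact this.comp measurable_id
      (measurable_pi_apply (⟨n, Finset.mem_singleton_self n⟩ : ({n} : Finset ℕ)))
  have hFu : ∀ α x, F (r α, x) = f (Function.update α n x) := by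
    intro α x
    refine hdep fun k hk => ?_
    rcases (Nat.lt_succ_iff.1 hk).eq_or_lt with rfl | hk'
    · simp
    · simp [hk', hk'.ne, r]
  have hpair : P.map (fun α => (r α, α n)) = (P.map r).prod (P.map fun α => α n) :=
    (indepFun_iff_map_prod_eq_prod_map_map hr.aemeasurable hn.aemeasurable).1 hind
  have := Measure.isProbabilityMeasure_map (μ := P) hn.aemeasurable
  calc ∫⁻ α, f α ∂P = ∫⁻ α, F (r α, α n) ∂P := by simp [hFu]
    _ = ∫⁻ p, F p ∂((P.map r).prod (P.map fun α => α n)) := by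
      rw [← hpair, lintegral_map hF (hr.prodMk hn)]
    _ = ∫⁻ u, ∫⁻ x, F (u, x) ∂(P.map fun α => α n) ∂(P.map r) := lintegral_prod _ hF.aemeasurable
    _ = _ := by
      rw [lintegral_map hF.lintegral_prod_right' hr]
      simp only [hFu]

section Law

variable (Q : Measure (ℕ → 𝔻))

/-- The law of `α_k` under `Q`, weighted by the Poisson kernel at `1`. -/
noncomputable def poissonLaw (k : ℕ) : Measure 𝔻 :=
  (Q.map fun α => α k).withDensity fun x => ENNReal.ofReal (poissonOne x)

variable {Q} [IsProbabilityMeasure Q]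

theorem isProbabilityMeasure_poissonLaw
    (hrot : ∀ (k : ℕ) (c : Circle), Q.map (fun α => c • α k) = Q.map (fun α => α k)) (k : ℕ) :
    IsProbabilityMeasure (poissonLaw Q k) := by
  have hk : Measurable fun α : ℕ → 𝔻 => α k := measurable_pi_apply k
  have := Measure.isProbabilityMeasure_map (μ := Q) hk.aemeasurable
  constructor
  rw [poissonLaw, withDensity_apply _ MeasurableSet.univ, Measure.restrict_univ]
  refine lintegral_poissonOne fun c => ?_
  rw [Measure.map_map (measurable_const_circle_smul c) hk]
  exact hrot k c

/-- The law of the rotated sequence, at the point `z`, of independent coefficients with the laws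
`poissonLaw Q k`. -/
noncomputable def tiltedLaw (Q : Measure (ℕ → 𝔻)) (z : Circle) : Measure (ℕ → 𝔻) :=
  (Measure.infinitePi (poissonLaw Q)).map (rotate z)

theorem rotate_update_of_lt (z : Circle) (β : ℕ → 𝔻) {k n : ℕ} (h : k < n) (y : 𝔻) :
    rotate z (Function.update β n y) k = rotate z β k :=
  rotate_congr fun _ hj => Function.update_of_ne (hj.trans_lt h).ne _ _

theorem rotate_update_self (z : Circle) (β : ℕ → 𝔻) (n : ℕ) (y : 𝔻) :
    rotate z (Function.update β n y) n = rotation z β n • y := by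
  rw [rotate, Function.update_self,
    rotation_congr fun k hk => Function.update_of_ne hk.ne _ _]

theorem bsDensity_pos (α : ℕ → 𝔻) (n : ℕ) (z : Circle) : 0 < bsDensity α n z :=
  div_pos (normProd_pos α n) (by have := eval_szego_ne_zero α n z; positivity)

theorem measurable_bsDensity_left (n : ℕ) (z : Circle) :
    Measurable fun α : ℕ → 𝔻 => bsDensity α n z := by
  have h : Continuous fun α : ℕ → 𝔻 => (α, z) := continuous_id.prodMk continuous_const
  exact ((continuous_bsDensity_uncurry n).comp h).measurable

theorem measurable_update_uncurry (n : ℕ) :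
    Measurable fun p : (ℕ → 𝔻) × 𝔻 => Function.update p.1 n p.2 := by
  refine measurable_pi_lambda _ fun k => ?_
  rcases eq_or_ne k n with rfl | h
  · simpa using measurable_snd
  · simpa [h, Function.comp_def] using (measurable_pi_apply k).comp measurable_fst

/-- On functions of the first `n` coefficients, the law of the rotated sequence has density
`|φ_n(z)|^{-2}` with respect to `Q`. -/
theorem lintegral_tiltedLaw (hindep : iIndepFun (fun (k : ℕ) (α : ℕ → 𝔻) => α k) Q)
    (hrot : ∀ (k : ℕ) (c : Circle), Q.map (fun α => c • α k) = Q.map (fun α => α k))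
    (z : Circle) (n : ℕ) {f : (ℕ → 𝔻) → ℝ≥0∞} (hf : Measurable f)
    (hdep : DependsOn f (Set.Iio n)) :
    ∫⁻ α, f α ∂(tiltedLaw Q z) = ∫⁻ α, f α * ENNReal.ofReal (bsDensity α n z) ∂Q := by
  have hprob := isProbabilityMeasure_poissonLaw hrot
  induction n generalizing f with
  | zero =>
    have hc : ∀ α, f α = f fun _ => 0 := fun α => hdep fun k hk => absurd hk (Nat.not_lt_zero k)
    have := Measure.isProbabilityMeasure_map (μ := Measure.infinitePi (poissonLaw Q))
      (measurable_rotate z).aemeasurable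
    rw [lintegral_congr hc, tiltedLaw, lintegral_const, measure_univ, mul_one,
      lintegral_congr (g := fun _ => f fun _ => 0) fun α => by simp [hc α, bsDensity, normProd],
      lintegral_const, measure_univ, mul_one]
  | succ n ih =>
    have hn : Measurable fun α : ℕ → 𝔻 => α n := measurable_pi_apply n
    have hQn := Measure.isProbabilityMeasure_map (μ := Q) hn.aemeasurable
    -- the integrand with the last coordinate integrated out, divided by the density of index `n`
    let G : (ℕ → 𝔻) × 𝔻 → ℝ≥0∞ := fun p => f (Function.update p.1 n p.2) *
      ENNReal.ofReal (bsDensity (Function.update p.1 n p.2) (n + 1) z / bsDensity p.1 n z)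
    have hG : Measurable G := by
      refine (hf.comp (measurable_update_uncurry n)).mul (Measurable.ennreal_ofReal ?_)
      exact ((measurable_bsDensity_left (n + 1) z).comp (measurable_update_uncurry n)).div
        ((measurable_bsDensity_left n z).comp measurable_fst)
    let g : (ℕ → 𝔻) → ℝ≥0∞ := fun α => ∫⁻ x, G (α, x) ∂(Q.map fun α => α n)
    have hg : Measurable g := hG.lintegral_prod_right'
    have hgdep : DependsOn g (Set.Iio n) := by
      intro α α' h
      refine lintegral_congr fun x => ?_
      have hu : ∀ k < n + 1, Function.update α n x k = Function.update α' n x k := by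
        intro k hk
        rcases (Nat.lt_succ_iff.1 hk).eq_or_lt with rfl | hk'
        · simp
        · simp [hk'.ne, h k hk']
      simp only [G]
      rw [hdep hu, bsDensity_congr hu, bsDensity_congr h]
    have hmap : (Measure.infinitePi (poissonLaw Q)).map (fun α => α n) = poissonLaw Q n :=
      Measure.infinitePi_map_eval _ n
    have hindP : iIndepFun (fun (k : ℕ) (α : ℕ → 𝔻) => α k) (Measure.infinitePi (poissonLaw Q)) :=
      iIndepFun_infinitePi (X := fun _ x => x) fun _ => measurable_id
    have hfT : DependsOn (fun β => f (rotate z β)) (Set.Iio (n + 1)) := by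
      intro β β' h
      exact hdep fun k hk => rotate_congr fun j hj => h j (hj.trans_lt hk)
    -- the inner integral, after the rotation of the last coordinate
    have hinner : ∀ β, ∫⁻ y, f (rotate z (Function.update β n y)) ∂(poissonLaw Q n) =
        g (rotate z β) := by
      intro β
      have h1 : ∀ y, f (rotate z (Function.update β n y)) =
          f (Function.update (rotate z β) n (rotation z β n • y)) := by
        intro y
        refine hdep fun k hk => ?_
        rcases (Nat.lt_succ_iff.1 hk).eq_or_lt with rfl | hk'
        · rw [rotate_update_self, Function.update_self]
        · rw [rotate_update_of_lt z β hk', Function.update_of_ne hk'.ne]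
      have h2 : ∀ y, bsDensity (Function.update (rotate z β) n (rotation z β n • y)) (n + 1) z /
          bsDensity (rotate z β) n z = poissonOne y := by
        intro y
        have hc : ∀ k < n, Function.update (rotate z β) n (rotation z β n • y) k = rotate z β k :=
          fun k hk => Function.update_of_ne hk.ne _ _
        rw [bsDensity_succ (Function.update_self _ _ _), bsDensity_congr hc,
          mul_div_cancel_left₀ _ (bsDensity_pos _ _ _).ne']
        have := szegoStar_rotate z β n
        rwa [szego, szegoStar, ← szegoPair_congr hc] at this
      have hmap' : (Q.map fun α => α n).map (fun x => rotation z β n • x) =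
          Q.map fun α => α n := by
        rw [Measure.map_map (measurable_const_circle_smul _) hn]
        exact hrot n _
      have hGm : Measurable fun x => G (rotate z β, x) := hG.comp measurable_prodMk_left
      have hfm : Measurable fun y => f (rotate z (Function.update β n y)) :=
        hf.comp ((measurable_rotate z).comp
          ((measurable_update_uncurry n).comp measurable_prodMk_left))
      simp only [g]
      rw [← hmap', lintegral_map hGm (measurable_const_circle_smul _), poissonLaw,
        lintegral_withDensity_eq_lintegral_mul _ measurable_ofReal_poissonOne hfm]
      refine lintegral_congr fun y => ?_
      simp only [Pi.mul_apply, G, h1, h2]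
      rw [mul_comm]
    have hfTm : Measurable fun β => f (rotate z β) := hf.comp (measurable_rotate z)
    have hfDm : Measurable fun α => f α * ENNReal.ofReal (bsDensity α (n + 1) z) :=
      hf.mul (measurable_bsDensity_left _ z).ennreal_ofReal
    have hfDdep : DependsOn (fun α => f α * ENNReal.ofReal (bsDensity α (n + 1) z))
        (Set.Iio (n + 1)) := by
      intro α α' h
      simp only
      rw [hdep h, bsDensity_congr h]
    calc ∫⁻ α, f α ∂(tiltedLaw Q z)
        = ∫⁻ β, f (rotate z β) ∂(Measure.infinitePi (poissonLaw Q)) := by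
          rw [tiltedLaw, lintegral_map hf (measurable_rotate z)]
      _ = ∫⁻ β, g (rotate z β) ∂(Measure.infinitePi (poissonLaw Q)) := by
          rw [lintegral_eq_lintegral_update hindP hfTm hfT, hmap]
          exact lintegral_congr hinner
      _ = ∫⁻ α, g α ∂(tiltedLaw Q z) := by
          rw [tiltedLaw, lintegral_map hg (measurable_rotate z)]
      _ = ∫⁻ α, g α * ENNReal.ofReal (bsDensity α n z) ∂Q := ih hg hgdep
      _ = ∫⁻ α, f α * ENNReal.ofReal (bsDensity α (n + 1) z) ∂Q := by
          rw [lintegral_eq_lintegral_update hindep hfDm hfDdep]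
          refine lintegral_congr fun α => ?_
          simp only [g]
          rw [← lintegral_mul_const' _ _ ENNReal.ofReal_ne_top]
          refine lintegral_congr fun x => ?_
          simp only [G]
          rw [mul_assoc, ← ENNReal.ofReal_mul (div_nonneg (bsDensity_nonneg _ _ _)
            (bsDensity_nonneg _ _ _)), div_mul_cancel₀ _ (bsDensity_pos _ _ _).ne']

end Law

/-! ### Cylinder sets -/

theorem coordSigma_le (n : ℕ) : coordSigma n ≤ MeasurableSpace.pi :=
  (measurable_pi_lambda _ fun _ => measurable_pi_apply _).comap_le

theorem coordSigma_mono {n m : ℕ} (h : n ≤ m) : coordSigma n ≤ coordSigma m := by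
  rintro _ ⟨B, hB, rfl⟩
  exact ⟨(fun u (k : Fin n) => u (Fin.castLE h k)) ⁻¹' B,
    (measurable_pi_lambda _ fun _ => measurable_pi_apply _) hB, rfl⟩

theorem measurableSet_coordSigma_eval {i n : ℕ} (h : i < n) {B : Set 𝔻} (hB : MeasurableSet B) :
    MeasurableSet[coordSigma n] ((fun α : ℕ → 𝔻 => α i) ⁻¹' B) :=
  ⟨(fun u => u ⟨i, h⟩) ⁻¹' B, measurable_pi_apply _ hB, rfl⟩

theorem dependsOn_indicator {n : ℕ} {A : Set (ℕ → 𝔻)} (hA : MeasurableSet[coordSigma n] A) :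
    DependsOn (A.indicator fun _ => (1 : ℝ≥0∞)) (Set.Iio n) := by
  obtain ⟨B, -, rfl⟩ := hA
  intro α α' h
  have : (fun k : Fin n => α k) = fun k : Fin n => α' k := funext fun k => h k k.2
  have hiff : α ∈ (fun (α : ℕ → 𝔻) (k : Fin n) => α k) ⁻¹' B ↔
      α' ∈ (fun (α : ℕ → 𝔻) (k : Fin n) => α k) ⁻¹' B := by
    rw [Set.mem_preimage, Set.mem_preimage, this]
  by_cases hα : α ∈ (fun (α : ℕ → 𝔻) (k : Fin n) => α k) ⁻¹' B
  · rw [Set.indicator_of_mem hα, Set.indicator_of_mem (hiff.1 hα)]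
  · rw [Set.indicator_of_notMem hα, Set.indicator_of_notMem (fun h => hα (hiff.2 h))]

/-- The sets depending on finitely many coordinates. -/
def cylinders : Set (Set (ℕ → 𝔻)) := {A | ∃ n, MeasurableSet[coordSigma n] A}

theorem isPiSystem_cylinders : IsPiSystem cylinders := by
  rintro A ⟨n, hA⟩ B ⟨m, hB⟩ -
  exact ⟨max n m, @MeasurableSet.inter _ (coordSigma (max n m)) _ _
    (coordSigma_mono (le_max_left n m) _ hA) (coordSigma_mono (le_max_right n m) _ hB)⟩

theorem generateFrom_cylinders :
    (MeasurableSpace.pi : MeasurableSpace (ℕ → 𝔻)) = MeasurableSpace.generateFrom cylinders := by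
  refine le_antisymm (iSup_le fun i => ?_) (MeasurableSpace.generateFrom_le ?_)
  · rintro _ ⟨B, hB, rfl⟩
    exact MeasurableSpace.measurableSet_generateFrom
      ⟨i + 1, measurableSet_coordSigma_eval i.lt_succ_self hB⟩
  · rintro A ⟨n, hA⟩
    exact coordSigma_le n _ hA

theorem exists_cylinder_subset {u : Set (ℕ → 𝔻)} (hu : IsOpen u) {α : ℕ → 𝔻} (hα : α ∈ u) :
    ∃ s ∈ cylinders, s ∈ 𝓝 α ∧ s ⊆ u := by
  obtain ⟨I, v, hv, hsub⟩ := isOpen_pi_iff.1 hu α hα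
  refine ⟨(I : Set ℕ).pi v, ⟨I.sup id + 1, ?_⟩,
    set_pi_mem_nhds I.finite_toSet fun i hi => (hv i hi).1.mem_nhds (hv i hi).2, hsub⟩
  rw [Set.pi_def]
  refine @Finset.measurableSet_biInter _ _ (coordSigma (I.sup id + 1)) _ I fun i hi => ?_
  exact measurableSet_coordSigma_eval (Nat.lt_succ_of_le (Finset.le_sup (f := id) hi))
    (hv i hi).1.measurableSet

/-! ### The biased measures and their limit -/

theorem biased_eq (Q : Measure (ℕ → 𝔻)) (z : Circle) (n : ℕ) :
    biased Q z n = Q.withDensity fun α => ENNReal.ofReal (bsDensity α n z) := by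
  rw [biased]
  congr 1; ext α
  rw [inv_norm_normalizedOP_sq (α := α)]
  rw [spectralMeasure_eq]
  exact isOrth_limitMeasure α

theorem tendsto_biased {Q : Measure (ℕ → 𝔻)} (z : Circle)
    (hprob : ∀ n, IsProbabilityMeasure (biased Q z n))
    {ν : ProbabilityMeasure (ℕ → 𝔻)}
    (hν : ∀ n A, MeasurableSet[coordSigma n] A → (ν : Measure (ℕ → 𝔻)) A = biased Q z n A) :
    Tendsto (β := ProbabilityMeasure (ℕ → 𝔻)) (fun n => ⟨biased Q z n, hprob n⟩) atTop (𝓝 ν) := by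
  refine isPiSystem_cylinders.tendsto_probabilityMeasure_of_tendsto_of_mem
    (fun A ⟨n, hA⟩ => coordSigma_le n _ hA) (fun u hu α hα => exists_cylinder_subset hu hα) ?_
  rintro A ⟨n, hA⟩
  refine tendsto_const_nhds.congr' ?_
  filter_upwards [eventually_ge_atTop n] with m hm
  exact congrArg ENNReal.toNNReal (hν m A (coordSigma_mono hm _ hA))

section Kernel

variable {Q : Measure (ℕ → 𝔻)} [IsProbabilityMeasure Q]

theorem tiltedLaw_eq_biased (hindep : iIndepFun (fun (k : ℕ) (α : ℕ → 𝔻) => α k) Q)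
    (hrot : ∀ (k : ℕ) (c : Circle), Q.map (fun α => c • α k) = Q.map (fun α => α k))
    (z : Circle) {n : ℕ} {A : Set (ℕ → 𝔻)} (hA : MeasurableSet[coordSigma n] A) :
    tiltedLaw Q z A = biased Q z n A := by
  have hA' := coordSigma_le n _ hA
  have h := lintegral_tiltedLaw hindep hrot z n (measurable_one.indicator hA')
    (dependsOn_indicator hA)
  rw [biased_eq, withDensity_apply _ hA', ← lintegral_indicator_one hA', ← lintegral_indicator hA']
  refine h.trans (lintegral_congr fun α => ?_)
  by_cases hα : α ∈ A <;> simp [hα]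

theorem isProbabilityMeasure_tiltedLaw
    (hrot : ∀ (k : ℕ) (c : Circle), Q.map (fun α => c • α k) = Q.map (fun α => α k)) (z : Circle) :
    IsProbabilityMeasure (tiltedLaw Q z) := by
  have := isProbabilityMeasure_poissonLaw hrot
  exact Measure.isProbabilityMeasure_map (measurable_rotate z).aemeasurable

theorem isProbabilityMeasure_biased (hindep : iIndepFun (fun (k : ℕ) (α : ℕ → 𝔻) => α k) Q)
    (hrot : ∀ (k : ℕ) (c : Circle), Q.map (fun α => c • α k) = Q.map (fun α => α k))
    (z : Circle) (n : ℕ) : IsProbabilityMeasure (biased Q z n) := by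
  have := isProbabilityMeasure_tiltedLaw hrot z
  exact ⟨by rw [← tiltedLaw_eq_biased hindep hrot z (@MeasurableSet.univ _ (coordSigma n)),
    measure_univ]⟩

theorem measurable_tiltedLaw
    (hrot : ∀ (k : ℕ) (c : Circle), Q.map (fun α => c • α k) = Q.map (fun α => α k)) :
    Measurable (tiltedLaw Q) := by
  have := isProbabilityMeasure_poissonLaw hrot
  refine Measure.measurable_of_measurable_coe _ fun s hs => ?_
  have h : ∀ z, tiltedLaw Q z s = Measure.infinitePi (poissonLaw Q)
      (Prod.mk z ⁻¹' ((fun p : Circle × (ℕ → 𝔻) => rotate p.1 p.2) ⁻¹' s)) := fun z => by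
    rw [tiltedLaw, Measure.map_apply (measurable_rotate z) hs]
    rfl
  simp only [h]
  exact measurable_measure_prodMk_left (continuous_rotate.measurable hs)

/-- The kernel `θ ↦ Q_θ`. -/
noncomputable def tiltedKernel
    (hrot : ∀ (k : ℕ) (c : Circle), Q.map (fun α => c • α k) = Q.map (fun α => α k)) :
    Kernel Circle (ℕ → 𝔻) := ⟨tiltedLaw Q, measurable_tiltedLaw hrot⟩

/-! ### The joint measure -/

/-- The kernel `α ↦ μ_α`. -/
noncomputable def spectralKernel : Kernel (ℕ → 𝔻) Circle :=
  ⟨spectralMeasure, measurable_spectralMeasure⟩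

instance : IsMarkovKernel spectralKernel :=
  ⟨fun α => inferInstanceAs (IsProbabilityMeasure (spectralMeasure α))⟩

theorem jointMeasure_eq_compProd : jointMeasure Q = Q ⊗ₘ spectralKernel := by
  have hm : ∀ s : Set ((ℕ → 𝔻) × Circle), MeasurableSet s → ∀ α,
      ((spectralMeasure α).map fun z => (α, z)) s = spectralKernel α (Prod.mk α ⁻¹' s) :=
    fun s hs α => Measure.map_apply measurable_prodMk_left hs
  ext s hs
  rw [Measure.compProd_apply hs, jointMeasure, Measure.bind_apply hs]
  · exact lintegral_congr (hm s hs)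
  · refine (Measure.measurable_of_measurable_coe _ fun t ht => ?_).aemeasurable
    simp only [hm t ht]
    exact Kernel.measurable_kernel_prodMk_left ht

/-- For a cylinder set `A`, the measure `∫_A μ_α dQ(α)` has density `Q_θ(A)`: it is the weak limit
of `∫_A |φ_N|^{-2} dQ dθ/2π`, whose density is eventually constant in `N`. -/
theorem bind_spectralKernel_restrict
    (hindep : iIndepFun (fun (k : ℕ) (α : ℕ → 𝔻) => α k) Q)
    (hrot : ∀ (k : ℕ) (c : Circle), Q.map (fun α => c • α k) = Q.map (fun α => α k))
    {n : ℕ} {A : Set (ℕ → 𝔻)} (hA : MeasurableSet[coordSigma n] A) :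
    (Q.restrict A).bind spectralKernel = lebesgueCircle.withDensity fun z => tiltedLaw Q z A := by
  have hA' := coordSigma_le n _ hA
  have hmeas : Measurable fun z => tiltedLaw Q z A :=
    (Measure.measurable_coe hA').comp (measurable_tiltedLaw hrot)
  refine ext_of_forall_lintegral_eq_of_IsFiniteMeasure fun f => ?_
  have hf : Measurable fun z => (f z : ℝ≥0∞) := f.continuous.measurable.coe_nnreal_ennreal
  rw [Measure.lintegral_bind spectralKernel.measurable.aemeasurable hf.aemeasurable,
    lintegral_withDensity_eq_lintegral_mul _ hmeas hf]
  have hlim : Tendsto (fun N => ∫⁻ α in A, ∫⁻ z, ENNReal.ofReal (bsDensity α N z) * f z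
      ∂lebesgueCircle ∂Q) atTop (𝓝 (∫⁻ α in A, ∫⁻ z, f z ∂(spectralKernel α) ∂Q)) := by
    refine tendsto_lintegral_of_dominated_convergence (fun _ => (nndist f 0 : ℝ≥0∞))
      (fun N => measurable_lintegral_bernsteinSzego N f) (fun N => ae_of_all _ fun α => ?_) ?_
      (ae_of_all _ fun α => tendsto_lintegral_bernsteinSzego α f)
    · refine (lintegral_bernsteinSzego α N hf).symm.le.trans ((lintegral_mono fun z => ENNReal.coe_le_coe.2
        (BoundedContinuousFunction.NNReal.upper_bound f z)).trans ?_)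
      simp
    · simp [ENNReal.mul_eq_top]
  refine tendsto_nhds_unique hlim (tendsto_const_nhds.congr' ?_)
  filter_upwards [eventually_ge_atTop n] with N hN
  rw [lintegral_lintegral_swap]
  · refine lintegral_congr fun z => ?_
    rw [Pi.mul_apply, tiltedLaw_eq_biased hindep hrot z (coordSigma_mono hN _ hA), biased_eq,
      withDensity_apply _ hA', lintegral_mul_const _ (measurable_bsDensity_left N z).ennreal_ofReal]
  · exact ((measurable_ofReal_bsDensity N).mul (hf.comp measurable_snd)).aemeasurable

theorem map_swap_jointMeasure
    (hindep : iIndepFun (fun (k : ℕ) (α : ℕ → 𝔻) => α k) Q)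
    (hrot : ∀ (k : ℕ) (c : Circle), Q.map (fun α => c • α k) = Q.map (fun α => α k))
    [IsMarkovKernel (tiltedKernel hrot)] :
    (jointMeasure Q).map Prod.swap = lebesgueCircle ⊗ₘ tiltedKernel hrot := by
  rw [jointMeasure_eq_compProd]
  have hcyl : ∀ {B : Set Circle}, MeasurableSet B → ∀ A ∈ cylinders,
      ((Q ⊗ₘ spectralKernel).map Prod.swap) (B ×ˢ A) =
        (lebesgueCircle ⊗ₘ tiltedKernel hrot) (B ×ˢ A) := by
    rintro B hB A ⟨n, hA⟩
    have hA' := coordSigma_le n _ hA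
    have h := congrArg (fun μ : Measure Circle => μ B) (bind_spectralKernel_restrict hindep hrot hA)
    simp only [Measure.bind_apply hB spectralKernel.measurable.aemeasurable,
      withDensity_apply _ hB] at h
    rw [Measure.map_apply measurable_swap (hB.prod hA'), Set.preimage_swap_prod,
      Measure.compProd_apply_prod hA' hB, Measure.compProd_apply_prod hB hA', h]
    rfl
  refine Measure.ext_prod fun {B A} hB hA => ?_
  -- for fixed `B`, both sides are finite measures in `A` that agree on the π-system of cylinders
  have happ : ∀ (ρ : Measure (Circle × (ℕ → 𝔻))) {A : Set (ℕ → 𝔻)}, MeasurableSet A →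
      (ρ.restrict (B ×ˢ Set.univ)).map Prod.snd A = ρ (B ×ˢ A) := by
    intro ρ A hA
    rw [Measure.map_apply measurable_snd hA, Measure.restrict_apply (measurable_snd hA)]
    congr 1; ext p
    simp [and_comm]
  rw [← happ _ hA, ← happ _ hA]
  refine congrArg (fun μ : Measure (ℕ → 𝔻) => μ A) (ext_of_generate_finite cylinders
    generateFrom_cylinders isPiSystem_cylinders (fun A' hA' => ?_) ?_)
  · have hm : MeasurableSet A' := by
      obtain ⟨n, hn⟩ := hA'
      exact coordSigma_le n _ hn
    rw [happ _ hm, happ _ hm, hcyl hB _ hA']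
  · rw [happ _ MeasurableSet.univ, happ _ MeasurableSet.univ,
      hcyl hB _ ⟨0, @MeasurableSet.univ _ (coordSigma 0)⟩]

end Kernel

end OPUC

theorem mainTheorem7 (Q : Measure (ℕ → 𝔻)) [IsProbabilityMeasure Q]
    (hindep : iIndepFun (fun (k : ℕ) (α : ℕ → 𝔻) => α k) Q)
    (hrot : ∀ (k : ℕ) (c : Circle), Q.map (fun α => c • α k) = Q.map (fun α => α k)) :
    (∀ α, OPUC.IsSpectralMeasure (OPUC.cmv α) OPUC.delta0 (OPUC.spectralMeasure α)) ∧
    Measurable OPUC.spectralMeasure ∧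
    (∀ z n m, n ≤ m → ∀ A, MeasurableSet[OPUC.coordSigma n] A →
      OPUC.biased Q z m A = OPUC.biased Q z n A) ∧
    ∃ hprob : ∀ z n, IsProbabilityMeasure (OPUC.biased Q z n),
    ∃ Qθ : Kernel Circle (ℕ → 𝔻), ∃ _ : IsMarkovKernel Qθ,
      (∀ z n A, MeasurableSet[OPUC.coordSigma n] A → Qθ z A = OPUC.biased Q z n A) ∧
      (∀ z, Tendsto (β := ProbabilityMeasure (ℕ → 𝔻))
        (fun n => ⟨OPUC.biased Q z n, hprob z n⟩) atTop (𝓝 ⟨Qθ z, inferInstance⟩)) ∧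
      IsProbabilityMeasure (OPUC.jointMeasure Q) ∧
      (OPUC.jointMeasure Q).snd = OPUC.lebesgueCircle ∧
      ((OPUC.jointMeasure Q).map Prod.swap).IsCondKernel Qθ := by
  have hM : IsMarkovKernel (OPUC.tiltedKernel hrot) :=
    ⟨fun z => OPUC.isProbabilityMeasure_tiltedLaw hrot z⟩
  have hprob := OPUC.isProbabilityMeasure_biased hindep hrot
  have hcyl : ∀ z n A, MeasurableSet[OPUC.coordSigma n] A →
      OPUC.tiltedKernel hrot z A = OPUC.biased Q z n A :=
    fun z n A hA => OPUC.tiltedLaw_eq_biased hindep hrot z hA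
  have hswap := OPUC.map_swap_jointMeasure hindep hrot
  have hfst : ((OPUC.jointMeasure Q).map Prod.swap).fst = OPUC.lebesgueCircle := by
    rw [hswap, Measure.fst_compProd]
  refine ⟨OPUC.isSpectralMeasure_spectralMeasure, OPUC.measurable_spectralMeasure,
    fun z n m hnm A hA => ?_, hprob, OPUC.tiltedKernel hrot, hM, hcyl,
    fun z => OPUC.tendsto_biased z (hprob z) (hcyl z), ?_, ?_, ?_⟩
  · rw [← hcyl z n A hA, ← hcyl z m A (OPUC.coordSigma_mono hnm A hA)]
  · rw [OPUC.jointMeasure_eq_compProd]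
    infer_instance
  · rw [← hfst, Measure.fst_map_swap]
  · exact ⟨by rw [hfst, hswap]⟩
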